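/- Consider diagrams of $2$-tangles in a rectangle, with fixed endpoints NW, NE, SW, SE. Two diagrams are isotopic, $T\sim S$, if they differ by a finite sequence of planar isotopies and Reidemeister moves inside the rectangle. Let $[0]$ be the tangle of two arcs joining NW to NE and SW to SE, $[\infty]$ the tangle of two vertical arcs, and $[\pm1]$ the two one-crossing tangles. In $[+1]$ the over strand joins NW to SE. The sum $T+S$ is formed by placing $T$ to the left of $S$ and joining the adjacent endpoints; the product $T*S$ by placing $T$ above $S$ and joining the adjacent endpoints. $-T$ is the mirror image (all crossings switched), $T^r$ is the counterclockwise rotation by $90^\circ$, and $\frac1T:=-T^r$. For an integer $n$, $[n]$ is the row of $|n|$ horizontal twists, each equal to $[+1]$ if $n>0$ and to $[-1]$ if $n<0$. Put $$[[a_1],\dots,[a_n]] := [a_1]+\frac{1}{[a_2]+\cdots+\frac{1}{[a_n]}} .$$ A tangle is in twist form if it is created from $[0]$ or $[\infty]$ by consecutive additions of and multiplications by $[\pm1]$ on any side; it is rational if it is isotopic to a tangle in twist form. A diagram is alternating if over- and undercrossings alternate along each component. A tangle is in canonical form if it is an alternating diagram $[[\beta_1],\dots,[\beta_m]]$ with $m$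 odd and with $\beta_1\ge 0,\ \beta_2,\dots,\beta_m>0$, or $\beta_1\le 0,\ \beta_2,\dots,\beta_m<0$ (so $\beta_1$ may be zero, and $[0]=[[0]]$ is included). **Proposition.** Every rational tangle is isotopic to $[\infty]$ or to a tangle in canonical form. More precisely, every tangle in twist form is carried to $[\infty]$ or to a tangle in canonical form by a finite sequence of planar isotopies and of the following moves, each applied to the whole tangle or to a subtangle from which the whole is created by additions of and multiplications by $[\pm1]$. Here $t^{hflip}$ and $t^{vflip}$ are the half turns of $t$ in space about a horizontal and a vertical axis in the plane. 1. Flypes $[\pm1]+t\leftrightarrow t^{hflip}+[\pm1]$, $\ t+[\pm1]\leftrightarrow[\pm1]+t^{hflip}$, $\ [\pm1]*t\leftrightarrow t^{vflip}*[\pm1]$, $\ t*[\pm1]\leftrightarrow[\pm1]*t^{vflip}$, with $t$ rational. They are isotopies and preserve the number of crossings. 2. Transfer moves $(t+[\mp1])*[\pm1]\to t^r+[\pm1]$ and $(t*[\mp1])+[\pm1]\to t^r*[\pm1]$, with $t$ rational; here $t^r=-\frac1t$. They are isotopies and lower the number of crossings by exactly one. 3. Untwistings $(t+[\mp1])+[\pm1]\to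 t$, $\ (t*[\mp1])*[\pm1]\to t$, $\ [\infty]+[\pm1]\to[\infty]$, $\ [0]*[\pm1]\to[0]$. They are isotopies and lower the number of crossings. -/

import Mathlib

namespace RationalTangle

/-! ### Planar tangle diagrams

A tangle diagram is drawn in a rectangle in general position with respect to the height function and
is read from top to bottom. It is cut by horizontal lines into slices, each of which contains exactly
one maximum, minimum or crossing, all other strands being vertical. -/

/-- The elementary pieces of a diagram: a maximum `∩`, a minimum `∪`, and the two crossings of two
strands. In `cross true` the over strand runs from upper left to lower right, in `cross false`
it runs from upper right to lower left. -/
inductive Gen : Type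
  | cap : Gen
  | cup : Gen
  | cross (ε : Bool) : Gen
  deriving DecidableEq

/-- Number of strands that enter a piece from above. -/
def Gen.ins : Gen → ℕ
  | .cap => 0
  | .cup => 2
  | .cross _ => 2

/-- Number of strands that leave a piece below. -/
def Gen.outs : Gen → ℕ
  | .cap => 2
  | .cup => 0
  | .cross _ => 2

/-- A slice: an elementary piece with exactly `pos` vertical strands to its left. -/
structure Slice : Type where
  gen : Gen
  pos : ℕ
  deriving DecidableEq

/-- The slices of a diagram, listed from top to bottom. -/
abbrev Word : Type := List Slice

/-- `∩` with `i` strands to the left of it. -/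
def cap (i : ℕ) : Slice := ⟨.cap, i⟩

/-- `∪` with `i` strands to the left of it. -/
def cup (i : ℕ) : Slice := ⟨.cup, i⟩

/-- A crossing with `i` strands to the left of it. -/
def cross (ε : Bool) (i : ℕ) : Slice := ⟨.cross ε, i⟩

/-- The number of strands below a slice that has `n` strands above it (`none` if it does not fit). -/
def stepCount (n : ℕ) (s : Slice) : Option ℕ :=
  if s.pos + s.gen.ins ≤ n then some (n - s.gen.ins + s.gen.outs) else none

/-- The number of strands below a word that has `n` strands above it (`none` if it does not fit). -/
def run : ℕ → Word → Option ℕ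
  | n, [] => some n
  | n, s :: w => (stepCount n s).bind fun m => run m w

/-- The same word with `k` more strands to its left. -/
def shift (k : ℕ) (w : Word) : Word := w.map fun s => ⟨s.gen, k + s.pos⟩

/-- Change every crossing. -/
def Gen.mirror : Gen → Gen
  | .cap => .cap
  | .cup => .cup
  | .cross ε => .cross (!ε)

/-- Turn a piece upside down by a half turn in space about a horizontal axis in the plane.
The type of a crossing does not change. -/
def Gen.hflip : Gen → Gen
  | .cap => .cup
  | .cup => .cap
  | .cross ε => .cross ε

/-- Change every crossing of a word. -/
def mirrorWord (w : Word) : Word := w.map fun s => ⟨s.gen.mirror, s.pos⟩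

/-- Half turn in space about a horizontal axis in the plane. -/
def hflipWord (w : Word) : Word := (w.map fun s => ⟨s.gen.hflip, s.pos⟩).reverse

/-- Half turn in space about a vertical axis in the plane, for a word with `n` strands above it.
Left and right are exchanged and the types of the crossings do not change. -/
def vflipWord : ℕ → Word → Word
  | _, [] => []
  | n, s :: w => ⟨s.gen, n - s.gen.ins - s.pos⟩ :: vflipWord (n - s.gen.ins + s.gen.outs) w

theorem run_append (u v : Word) (n : ℕ) : run n (u ++ v) = (run n u).bind fun m => run m v := by
  induction u generalizing n with
  | nil => rfl
  | cons s u ih =>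
    simp only [List.cons_append, run]
    cases stepCount n s <;> simp [ih]

theorem run_cons_some {s : Slice} {w : Word} {n m : ℕ} :
    run n (s :: w) = some m ↔
      s.pos + s.gen.ins ≤ n ∧ run (n - s.gen.ins + s.gen.outs) w = some m := by
  simp only [run, stepCount]
  split_ifs with h <;> simp [h]

theorem run_shift {w : Word} {n m : ℕ} (k l : ℕ) (h : run n w = some m) :
    run (k + n + l) (shift k w) = some (k + m + l) := by
  induction w generalizing n with
  | nil => simp only [run, Option.some.injEq] at h; subst h; rfl
  | cons s w ih =>
    obtain ⟨h1, h2⟩ := run_cons_some.1 h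
    simp only [shift, List.map_cons]
    refine run_cons_some.2 ⟨by simp only; omega, ?_⟩
    have := ih h2
    simp only [shift] at this ⊢
    rw [← this]
    congr 1
    omega

theorem run_mirror {w : Word} {n m : ℕ} (h : run n w = some m) :
    run n (mirrorWord w) = some m := by
  induction w generalizing n with
  | nil => exact h
  | cons s w ih =>
    obtain ⟨h1, h2⟩ := run_cons_some.1 h
    obtain ⟨g, i⟩ := s
    simp only [mirrorWord, List.map_cons]
    cases g <;> exact run_cons_some.2 ⟨h1, ih h2⟩

theorem run_hflip {w : Word} {n m : ℕ} (h : run n w = some m) :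
    run m (hflipWord w) = some n := by
  induction w generalizing n with
  | nil => simp only [run, Option.some.injEq] at h; subst h; rfl
  | cons s w ih =>
    obtain ⟨h1, h2⟩ := run_cons_some.1 h
    have h3 := ih h2
    obtain ⟨g, i⟩ := s
    simp only [hflipWord, List.map_cons, List.reverse_cons] at h3 ⊢
    rw [run_append, h3]
    cases g <;> simp only [Option.bind_some, Gen.ins, Gen.outs, Gen.hflip] at h1 ⊢ <;>
      refine run_cons_some.2 ⟨?_, ?_⟩ <;>
      simp only [Gen.ins, Gen.outs, run, Option.some.injEq] <;> omega

theorem run_vflip {w : Word} {n m : ℕ} (h : run n w = some m) :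
    run n (vflipWord n w) = some m := by
  induction w generalizing n with
  | nil => exact h
  | cons s w ih =>
    obtain ⟨h1, h2⟩ := run_cons_some.1 h
    exact run_cons_some.2 ⟨by simp only; omega, ih h2⟩

/-- A diagram of a 2-tangle: two endpoints NW, NE on the upper and two endpoints SW, SE on the lower
boundary line of the rectangle. -/
@[ext] structure TwoTangle : Type where
  word : Word
  wf : run 2 word = some 2

/-- The number of crossings of a diagram. -/
def TwoTangle.crossings (T : TwoTangle) : ℕ :=
  T.word.countP fun s => match s.gen with
    | .cross _ => true
    | _ => false

/-! ### Isotopy -/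

/-- The local moves of planar isotopy between words. -/
inductive PlanarMove : Word → Word → Prop
  /-- Two pieces next to each other, `g` on the left and `h` on the right with `k` strands
  in between, may be moved past each other vertically. -/
  | interchange (g h : Gen) (i k : ℕ) :
      PlanarMove [⟨g, i⟩, ⟨h, i + g.outs + k⟩] [⟨h, i + g.ins + k⟩, ⟨g, i⟩]
  /-- Straightening of a zigzag. -/
  | zigzag_left (i : ℕ) : PlanarMove [cap i, cup (i + 1)] []
  /-- Straightening of a zigzag. -/
  | zigzag_right (i : ℕ) : PlanarMove [cap (i + 1), cup i] []
  /-- A crossing on one side of a maximum is turned over to the other side. -/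
  | cap_cross (ε : Bool) (i : ℕ) :
      PlanarMove [cap i, cross ε (i + 1)] [cap (i + 1), cross (!ε) i]
  /-- A crossing on one side of a minimum is turned over to the other side. -/
  | cup_cross (ε : Bool) (i : ℕ) :
      PlanarMove [cross ε i, cup (i + 1)] [cross (!ε) (i + 1), cup i]

/-- The Reidemeister moves. Together with planar isotopy they generate all other versions of these
moves. -/
inductive ReidemeisterMove : Word → Word → Prop
  | one_cap (ε : Bool) (i : ℕ) : ReidemeisterMove [cap i, cross ε i] [cap i]
  | one_cup (ε : Bool) (i : ℕ) : ReidemeisterMove [cross ε i, cup i] [cup i]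
  | two (ε : Bool) (i : ℕ) : ReidemeisterMove [cross ε i, cross (!ε) i] []
  | three (ε : Bool) (i : ℕ) :
      ReidemeisterMove [cross ε i, cross ε (i + 1), cross ε i]
        [cross ε (i + 1), cross ε i, cross ε (i + 1)]

/-- `T` is obtained from `S` by applying a local move from `M` to a group of consecutive slices. -/
def LocalStep (M : Word → Word → Prop) (S T : TwoTangle) : Prop :=
  ∃ p q x y : Word, M x y ∧ S.word = p ++ x ++ q ∧ T.word = p ++ y ++ q

/-- Isotopy of the diagram in the plane, with fixed endpoints. -/
def PlanarIsotopic : TwoTangle → TwoTangle → Prop :=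
  Relation.EqvGen (LocalStep PlanarMove)

/-- Isotopy of 2-tangles with fixed endpoints: the diagrams differ by a finite sequence of planar
isotopies and Reidemeister moves, and of their inverses. -/
def Isotopic : TwoTangle → TwoTangle → Prop :=
  Relation.EqvGen (LocalStep fun x y => PlanarMove x y ∨ ReidemeisterMove x y)

/-! ### Operations on 2-tangles -/

namespace TwoTangle

/-- The tangle `[0]`: one arc joins the two upper, the other the two lower endpoints. -/
def zero : TwoTangle := ⟨[RationalTangle.cup 0, RationalTangle.cap 0], by decide⟩

/-- The tangle `[∞]`: two vertical arcs. -/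
def infty : TwoTangle := ⟨[], rfl⟩

/-- The tangles `[+1]` (for `true`) and `[-1]` (for `false`). -/
def unit (ε : Bool) : TwoTangle := ⟨[RationalTangle.cross ε 0], by cases ε <;> rfl⟩

/-- The sum: `T` is placed to the left of `S`, and the right endpoints of `T` are
joined to the left endpoints of `S`. -/
def add (T S : TwoTangle) : TwoTangle :=
  ⟨RationalTangle.cap 1 :: (T.word ++ shift 2 S.word ++ [RationalTangle.cup 1]), by
    refine run_cons_some.2 ⟨by decide, ?_⟩
    have hT := run_shift 0 2 T.wf
    have hS := run_shift 2 0 S.wf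
    have h0 : shift 0 T.word = T.word := by simp [shift]
    rw [h0] at hT
    rw [run_append, run_append]
    change ((run 4 T.word).bind _).bind _ = _
    rw [show run 4 T.word = some 4 from hT, Option.bind_some,
      show run 4 (shift 2 S.word) = some 4 from hS]
    rfl⟩

/-- The product: `T` is placed above `S`, and the lower endpoints of `T` are
joined to the upper endpoints of `S`. -/
def mul (T S : TwoTangle) : TwoTangle :=
  ⟨T.word ++ S.word, by rw [run_append, T.wf]; exact S.wf⟩

instance : Add TwoTangle := ⟨add⟩

instance : Mul TwoTangle := ⟨mul⟩

/-- The mirror image `-T`: all crossings are switched. -/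
def mirror (T : TwoTangle) : TwoTangle := ⟨mirrorWord T.word, run_mirror T.wf⟩

instance : Neg TwoTangle := ⟨mirror⟩

/-- The rotation by a quarter turn counterclockwise: the old endpoints NE, SE, NW, SW become the new
endpoints NW, NE, SW, SE. The old NW is bent down on the left, the old SE is bent up on the right. -/
def rot (T : TwoTangle) : TwoTangle :=
  ⟨RationalTangle.cap 0 :: (shift 1 T.word ++ [RationalTangle.cup 2]), by
    refine run_cons_some.2 ⟨by decide, ?_⟩
    rw [run_append]
    change (run (1 + 2 + 1) (shift 1 T.word)).bind _ = _
    rw [run_shift 1 1 T.wf]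
    rfl⟩

/-- The inverse `1/T`: the mirror image of the rotation of `T`. -/
def inv (T : TwoTangle) : TwoTangle := -T.rot

/-- The horizontal flip. -/
def hflip (T : TwoTangle) : TwoTangle := ⟨hflipWord T.word, run_hflip T.wf⟩

/-- The vertical flip. -/
def vflip (T : TwoTangle) : TwoTangle := ⟨vflipWord 2 T.word, run_vflip T.wf⟩

/-- A row of `k` horizontal twists of type `ε`. -/
def twists (ε : Bool) : ℕ → TwoTangle
  | 0 => zero
  | k + 1 => twists ε k + unit ε

/-- The integer tangle `[n]`. -/
def int (n : ℤ) : TwoTangle := twists (decide (0 ≤ n)) n.natAbs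

/-- The continued fraction in integer tangles `[[a], [b₁], …, [bₖ]]`, that is
`[a] + 1/([b₁] + 1/(⋯ + 1/[bₖ]))`. -/
def contFrac : ℤ → List ℤ → TwoTangle
  | a, [] => int a
  | a, b :: l => int a + inv (contFrac b l)

end TwoTangle

/-! ### Rational tangles -/

open TwoTangle in
/-- Tangles in twist form: those created by consecutive additions of and multiplications by `[±1]`
on any side, starting from `[0]` or `[∞]`. -/
inductive TwistForm : TwoTangle → Prop
  | zero : TwistForm zero
  | infty : TwistForm infty
  | add_right {T : TwoTangle} (ε : Bool) : TwistForm T → TwistForm (T + unit ε)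
  | add_left {T : TwoTangle} (ε : Bool) : TwistForm T → TwistForm (unit ε + T)
  | mul_bottom {T : TwoTangle} (ε : Bool) : TwistForm T → TwistForm (T * unit ε)
  | mul_top {T : TwoTangle} (ε : Bool) : TwistForm T → TwistForm (unit ε * T)

/-- A 2-tangle is rational if it is isotopic to a tangle in twist form. -/
def IsRational (T : TwoTangle) : Prop := ∃ S, TwistForm S ∧ Isotopic T S

/-! ### Alternating diagrams and canonical form

A diagram is alternating if over- and undercrossings alternate along every component. Equivalently,
each segment of a strand between two consecutive passages through crossings is an
undercrossing at one end and an overcrossing at the other, so that all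
segments can be directed from their under end to their over end
(segments with an end on the boundary in the one possible way). Near a crossing both
over segments then point towards it and both under segments away from it. Directions
of the strands at a given height are recorded by `true` for downwards, `false` for upwards. -/

/-- Compatible directions just above and just below a piece. -/
inductive GenDirections : Gen → List Bool → List Bool → Prop
  | cap (x : Bool) : GenDirections .cap [] [x, !x]
  | cup (x : Bool) : GenDirections .cup [x, !x] []
  | cross (ε : Bool) : GenDirections (.cross ε) [ε, !ε] [ε, !ε]

/-- Compatible directions of the strands at the top and at the bottom of a word. -/
inductive WordDirections : Word → List Bool → List Bool → Prop
  | nil (l : List Bool) : WordDirections [] l l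
  | cons (g : Gen) (w : Word) (p q a b l : List Bool) : GenDirections g a b →
      WordDirections w (p ++ b ++ q) l → WordDirections (⟨g, p.length⟩ :: w) (p ++ a ++ q) l

/-- The diagram is alternating. -/
def Alternating (T : TwoTangle) : Prop :=
  ∃ l l' : List Bool, l.length = 2 ∧ WordDirections T.word l l'

/-- `T` is in canonical form: it is an alternating continued fraction `[[β₁], …, [βₘ]]` with `m` odd,
whose terms are all positive or all negative, except that `β₁` may be zero. -/
def IsCanonical (T : TwoTangle) : Prop :=
  ∃ (β₁ : ℤ) (β : List ℤ), T = TwoTangle.contFrac β₁ β ∧ Odd (β₁ :: β).length ∧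
    ((0 ≤ β₁ ∧ ∀ b ∈ β, 0 < b) ∨ (β₁ ≤ 0 ∧ ∀ b ∈ β, b < 0)) ∧ Alternating T

/-! ### Flypes, transfer moves and untwistings -/

open TwoTangle in
/-- Rational flypes: a crossing is moved to the opposite side of a rational
tangle `t`, which is flipped. -/
inductive Flype : TwoTangle → TwoTangle → Prop
  | right (ε : Bool) (t : TwoTangle) : IsRational t → Flype (unit ε + t) (t.hflip + unit ε)
  | left (ε : Bool) (t : TwoTangle) : IsRational t → Flype (t + unit ε) (unit ε + t.hflip)
  | down (ε : Bool) (t : TwoTangle) : IsRational t → Flype (unit ε * t) (t.vflip * unit ε)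
  | up (ε : Bool) (t : TwoTangle) : IsRational t → Flype (t * unit ε) (unit ε * t.vflip)

open TwoTangle in
/-- Transfer moves: `(t + [∓1]) * [±1]` is replaced by `-1/t + [±1]`, and `(t * [∓1]) + [±1]` by
`-1/t * [±1]`, where `-1/t` is the rotation of the rational tangle `t`. -/
inductive Transfer : TwoTangle → TwoTangle → Prop
  | horizontal (ε : Bool) (t : TwoTangle) : IsRational t →
      Transfer ((t + unit (!ε)) * unit ε) (t.rot + unit ε)
  | vertical (ε : Bool) (t : TwoTangle) : IsRational t →
      Transfer ((t * unit (!ε)) + unit ε) (t.rot * unit ε)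

open TwoTangle in
/-- Untwistings: two adjacent opposite twists cancel, and so does a curl. -/
inductive Untwist : TwoTangle → TwoTangle → Prop
  | add (ε : Bool) (t : TwoTangle) : Untwist ((t + unit (!ε)) + unit ε) t
  | mul (ε : Bool) (t : TwoTangle) : Untwist ((t * unit (!ε)) * unit ε) t
  | infty (ε : Bool) : Untwist (infty + unit ε) infty
  | zero (ε : Bool) : Untwist (zero * unit ε) zero

open TwoTangle in
/-- A move from `M` is applied to a subtangle from which the whole tangle is created by additions of
and multiplications by `[±1]`. -/
inductive OnSubtangle (M : TwoTangle → TwoTangle → Prop) : TwoTangle → TwoTangle → Prop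
  | base {S T : TwoTangle} : M S T → OnSubtangle M S T
  | add_right {S T : TwoTangle} (ε : Bool) :
      OnSubtangle M S T → OnSubtangle M (S + unit ε) (T + unit ε)
  | add_left {S T : TwoTangle} (ε : Bool) :
      OnSubtangle M S T → OnSubtangle M (unit ε + S) (unit ε + T)
  | mul_bottom {S T : TwoTangle} (ε : Bool) :
      OnSubtangle M S T → OnSubtangle M (S * unit ε) (T * unit ε)
  | mul_top {S T : TwoTangle} (ε : Bool) :
      OnSubtangle M S T → OnSubtangle M (unit ε * S) (unit ε * T)

/-- One step of the reduction of a rational tangle. -/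
def ReductionStep (S T : TwoTangle) : Prop :=
  PlanarIsotopic S T ∨ OnSubtangle Flype S T ∨ OnSubtangle Transfer S T ∨ OnSubtangle Untwist S T

end RationalTangle

/-! ### Calculus of words: equivalence with strand counts, shifting, interchange. -/

namespace RationalTangle

/-! ### Equivalence of words -/

/-! Twists are attached one at a time while the tangle built so far is kept normal: `[∞]`, or a
continued fraction whose terms share one sign (`signedFrac`). Apart from the degenerate cases `[∞]`
and `[0]`, a new twist of that sign raises the first term, raises the second when a product is taken
and the first is zero, or opens two new terms through `T * [±1] = 1/([±1] + 1/T)`. A twist of the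
other sign either meets an opposite twist in its own direction and cancels it, or meets one in the
perpendicular direction; then a transfer move trades the two crossings for one crossing and a
quarter turn. What is left need not be normal, but it has fewer crossings, so strong induction on
the number of crossings finishes the argument (`IsNormal.hasNormalForm_add`,
`IsNormal.hasNormalForm_mul`, `PlanarTwistForm.hasNormalForm`).

It suffices to attach twists on the right and at the bottom: up to flypes, flips do not change a
tangle in twist form (`TwistForm.flypeEquiv_flip`), so twists on opposite sides are interchangeable,
and a rotation by a half turn is trivial (`TwistForm.flypeEquiv_rot_rot`).

That the moves are isotopies rests on one fact: a half twist of all strands can be pulled through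
any word, which it flips about a vertical axis (`halfTwist_word`). For two strands in and out this
is the vertical flype. For one strand in and three out it gives the horizontal transfer move.
Quarter turns and flips give the other versions.

Continued fractions of one sign are alternating because a fixed pattern of directions at the four
endpoints survives sums and inverses (`AlternatingOfSign`). -/

/-- A local move from `M` inside a word with `n` strands above it. -/
def WordStep (M : Word → Word → Prop) (n : ℕ) (u v : Word) : Prop :=
  ∃ p q x y : Word, ∃ k l : ℕ, M x y ∧ run n p = some k ∧ run k x = some l ∧ run k y = some l ∧
    u = p ++ (x ++ q) ∧ v = p ++ (y ++ q)

/-- Equivalence of words with `n` strands above them under the local moves from `M`. -/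
def WordEq (M : Word → Word → Prop) (n : ℕ) : Word → Word → Prop :=
  Relation.EqvGen (WordStep M n)

/-- The local moves of isotopy. -/
def IsotopyMove (x y : Word) : Prop := PlanarMove x y ∨ ReidemeisterMove x y

variable {M : Word → Word → Prop} {n m : ℕ} {u v w : Word}

namespace WordEq

theorem refl (u : Word) : WordEq M n u u := Relation.EqvGen.refl u

theorem symm (h : WordEq M n u v) : WordEq M n v u := Relation.EqvGen.symm _ _ h

theorem trans (h : WordEq M n u v) (h' : WordEq M n v w) : WordEq M n u w :=
  Relation.EqvGen.trans _ _ _ h h'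

theorem lift {M' : Word → Word → Prop} {n' : ℕ} (f : Word → Word)
    (hf : ∀ u v, WordStep M n u v → WordEq M' n' (f u) (f v)) (h : WordEq M n u v) :
    WordEq M' n' (f u) (f v) := by
  induction h with
  | rel x y h => exact hf x y h
  | refl x => exact refl _
  | symm x y _ ih => exact ih.symm
  | trans x y z _ _ ih ih' => exact ih.trans ih'

theorem mono {M' : Word → Word → Prop} (hM : ∀ x y, M x y → M' x y) (h : WordEq M n u v) :
    WordEq M' n u v :=
  lift id (fun _ _ ⟨p, q, x, y, k, l, h, h'⟩ => .rel _ _ ⟨p, q, x, y, k, l, hM _ _ h, h'⟩) h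

theorem run_eq (h : WordEq M n u v) : run n u = run n v := by
  induction h with
  | rel x y h =>
    obtain ⟨p, q, x, y, k, l, -, hp, hx, hy, rfl, rfl⟩ := h
    simp [run_append, hp, hx, hy]
  | refl x => rfl
  | symm x y _ ih => exact ih.symm
  | trans x y z _ _ ih ih' => exact ih.trans ih'

theorem append_right (h : WordEq M n u v) (q : Word) : WordEq M n (u ++ q) (v ++ q) :=
  lift (· ++ q) (fun _ _ ⟨p, q', x, y, k, l, h, hp, hx, hy, hu, hv⟩ =>
    .rel _ _ ⟨p, q' ++ q, x, y, k, l, h, hp, hx, hy, by simp [hu], by simp [hv]⟩) h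

theorem append_left {p : Word} (hp : run n p = some m) (h : WordEq M m u v) :
    WordEq M n (p ++ u) (p ++ v) :=
  lift (p ++ ·) (fun _ _ ⟨p', q', x, y, k, l, h, hp', hx, hy, hu, hv⟩ =>
    .rel _ _ ⟨p ++ p', q', x, y, k, l, h, by simp [run_append, hp, hp'], hx, hy, by simp [hu],
      by simp [hv]⟩) h

theorem cons (s : Slice) (hs : s.pos + s.gen.ins ≤ n)
    (h : WordEq M (n - s.gen.ins + s.gen.outs) u v) : WordEq M n (s :: u) (s :: v) :=
  append_left (p := [s]) (run_cons_some.2 ⟨hs, rfl⟩) h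

theorem of_move {x y : Word} {l : ℕ} (h : M x y) (hx : run n x = some l) (hy : run n y = some l)
    (q : Word) : WordEq M n (x ++ q) (y ++ q) :=
  .rel _ _ ⟨[], q, x, y, n, l, h, rfl, hx, hy, rfl, rfl⟩

theorem of_planar (h : WordEq PlanarMove n u v) : WordEq IsotopyMove n u v := h.mono fun _ _ => .inl

end WordEq

/-- With `wordEq_of_eqvGen` this lets isotopies be computed on words with any number of strands,
where equivalences can be inserted into larger diagrams. -/
theorem eqvGen_of_wordEq {S T : TwoTangle} (h : WordEq M 2 S.word T.word) :
    Relation.EqvGen (LocalStep M) S T := by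
  have key : ∀ u v, WordEq M 2 u v → ∀ S T : TwoTangle, S.word = u → T.word = v →
      Relation.EqvGen (LocalStep M) S T := by
    intro u v h
    induction h with
    | rel x y h =>
      rintro S T rfl rfl
      obtain ⟨p, q, x, y, k, l, h, -, -, -, hu, hv⟩ := h
      exact .rel _ _ ⟨p, q, x, y, h, by simp [hu], by simp [hv]⟩
    | refl x =>
      intro S T hS hT
      obtain rfl : S = T := TwoTangle.ext (hS.trans hT.symm)
      exact .refl _
    | symm x y _ ih => exact fun S T hS hT => .symm _ _ (ih T S hT hS)
    | trans x y z h _ ih ih' =>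
      rintro S T rfl rfl
      -- The intermediate word is again a 2-tangle, because equivalent words have the same strand
      -- counts.
      have := WordEq.run_eq h
      exact .trans _ ⟨y, by rw [← this]; exact S.wf⟩ _ (ih _ _ rfl rfl) (ih' _ _ rfl rfl)
  exact key _ _ h S T rfl rfl

/-- Local moves that do not change the number of strands. -/
def Balanced (M : Word → Word → Prop) : Prop :=
  ∀ x y, M x y → ∀ n k l, run n x = some k → run n y = some l → k = l

theorem run_nil_iff : run n [] = some m ↔ n = m := by simp [run]

theorem balanced_isotopyMove : Balanced IsotopyMove := by
  rintro x y (h | h) n k l hx hy <;> cases h <;>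
    simp only [run_cons_some, run_nil_iff, cap, cup, cross, Gen.ins, Gen.outs] at hx hy <;> omega

theorem balanced_planarMove : Balanced PlanarMove :=
  fun x y h => balanced_isotopyMove x y (.inl h)

/-- A `LocalStep` only knows that the two whole diagrams are well formed. The common prefix fixes
the number of strands above the move, and balance then forces equal numbers below it. -/
theorem wordEq_of_eqvGen (hM : Balanced M) {S T : TwoTangle}
    (h : Relation.EqvGen (LocalStep M) S T) : WordEq M 2 S.word T.word := by
  induction h with
  | rel S T h =>
    obtain ⟨p, q, x, y, h, hS, hT⟩ := h
    have h1 := S.wf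
    have h2 := T.wf
    rw [hS, List.append_assoc, run_append, Option.bind_eq_some_iff] at h1
    rw [hT, List.append_assoc, run_append, Option.bind_eq_some_iff] at h2
    obtain ⟨k, hk, h1⟩ := h1
    obtain ⟨k', hk', h2⟩ := h2
    obtain rfl : k = k' := by simpa [hk] using hk'
    rw [run_append, Option.bind_eq_some_iff] at h1 h2
    obtain ⟨a, ha, -⟩ := h1
    obtain ⟨b, hb, -⟩ := h2
    obtain rfl := hM x y h k a b ha hb
    exact .rel _ _ ⟨p, q, x, y, k, a, h, hk, ha, hb, by simp [hS], by simp [hT]⟩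
  | refl x => exact .refl _
  | symm x y _ ih => exact ih.symm
  | trans x y z _ _ ih ih' => exact ih.trans ih'

theorem isotopic_iff {S T : TwoTangle} : Isotopic S T ↔ WordEq IsotopyMove 2 S.word T.word :=
  ⟨wordEq_of_eqvGen balanced_isotopyMove, eqvGen_of_wordEq⟩

theorem planarIsotopic_iff {S T : TwoTangle} :
    PlanarIsotopic S T ↔ WordEq PlanarMove 2 S.word T.word :=
  ⟨wordEq_of_eqvGen balanced_planarMove, eqvGen_of_wordEq⟩

/-! ### Shifted words -/

theorem shift_zero (w : Word) : shift 0 w = w := by simp [shift]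

theorem shift_shift (k l : ℕ) (w : Word) : shift k (shift l w) = shift (k + l) w := by
  simp [shift, add_assoc]

theorem shift_append (k : ℕ) (u v : Word) : shift k (u ++ v) = shift k u ++ shift k v := by
  simp [shift]

theorem shift_cons (k : ℕ) (s : Slice) (w : Word) :
    shift k (s :: w) = ⟨s.gen, k + s.pos⟩ :: shift k w := rfl

theorem shift_nil (k : ℕ) : shift k [] = [] := rfl

/-- Local moves that can be applied anywhere in a row of strands. -/
def Shiftable (M : Word → Word → Prop) : Prop := ∀ x y, M x y → ∀ k, M (shift k x) (shift k y)

theorem shiftable_planarMove : Shiftable PlanarMove := by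
  intro x y h k
  cases h with
  | interchange g h i j =>
    simpa [shift, add_assoc] using PlanarMove.interchange g h (k + i) j
  | zigzag_left i => exact .zigzag_left (k + i)
  | zigzag_right i => exact .zigzag_right (k + i)
  | cap_cross ε i => exact .cap_cross ε (k + i)
  | cup_cross ε i => exact .cup_cross ε (k + i)

theorem shiftable_isotopyMove : Shiftable IsotopyMove := by
  rintro x y (h | h) k
  · exact .inl (shiftable_planarMove x y h k)
  · right
    cases h with
    | one_cap ε i => exact .one_cap ε (k + i)
    | one_cup ε i => exact .one_cup ε (k + i)
    | two ε i => exact .two ε (k + i)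
    | three ε i => exact .three ε (k + i)

theorem WordEq.shift (hM : Shiftable M) (k l : ℕ) (h : WordEq M n u v) :
    WordEq M (k + n + l) (shift k u) (shift k v) :=
  lift (RationalTangle.shift k) (fun _ _ ⟨p, q, x, y, a, b, h, hp, hx, hy, hu, hv⟩ =>
    .rel _ _ ⟨RationalTangle.shift k p, RationalTangle.shift k q, RationalTangle.shift k x,
      RationalTangle.shift k y, k + a + l, k + b + l, hM _ _ h k, run_shift k l hp,
      run_shift k l hx, run_shift k l hy, by simp [hu, shift_append],
      by simp [hv, shift_append]⟩) h

/-! ### Interchange -/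

/-- A piece on the left and a piece on the right are moved past each other. -/
theorem interchange (g h : Gen) (i : ℕ) {j j' : ℕ} (q : Word) (hij : i + g.ins ≤ j)
    (hj : j + h.ins ≤ n) (hj' : j' + g.ins = j + g.outs) :
    WordEq PlanarMove n (⟨g, i⟩ :: ⟨h, j'⟩ :: q) (⟨h, j⟩ :: ⟨g, i⟩ :: q) := by
  obtain ⟨k, rfl⟩ := Nat.exists_eq_add_of_le hij
  obtain rfl : j' = i + g.outs + k := by omega
  refine WordEq.of_move (l := n - g.ins + g.outs - h.ins + h.outs)
    (PlanarMove.interchange g h i k) ?_ ?_ q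
  · simp only [run_cons_some, run_nil_iff, and_true]; omega
  · simp only [run_cons_some, run_nil_iff]; omega

theorem slice_interchange (g : Gen) (i : ℕ) {a b j j' : ℕ} (hv : run a v = some b) (q : Word)
    (hij : i + g.ins ≤ j) (hj : j + a ≤ n) (hj' : j' + g.ins = j + g.outs) :
    WordEq PlanarMove n (⟨g, i⟩ :: (shift j' v ++ q)) (shift j v ++ ⟨g, i⟩ :: q) := by
  induction v generalizing n a with
  | nil => exact .refl _
  | cons s v ih =>
    obtain ⟨h1, h2⟩ := run_cons_some.1 hv
    simp only [shift_cons, List.cons_append]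
    refine (interchange g s.gen i (j := j + s.pos) _ (by omega) (by omega) (by omega)).trans ?_
    exact .cons _ (by simp only; omega) (ih h2 (by simp only; omega))

/-- A word on the left and a word on the right are moved past each other. -/
theorem word_interchange {a b N j j' : ℕ} (hu : run n u = some m) (hv : run a v = some b)
    (q : Word) (hj : n ≤ j) (hN : j + a ≤ N) (hj' : j' + n = j + m) :
    WordEq PlanarMove N (u ++ (shift j' v ++ q)) (shift j v ++ (u ++ q)) := by
  induction u generalizing n j N with
  | nil =>
    obtain rfl : n = m := run_nil_iff.1 hu
    obtain rfl : j' = j := by omega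
    exact .refl _
  | cons s u ih =>
    obtain ⟨h1, h2⟩ := run_cons_some.1 hu
    refine (WordEq.cons s (by omega)
      (ih (j := j - s.gen.ins + s.gen.outs) h2 (by omega) (by omega) (by omega))).trans ?_
    exact slice_interchange s.gen s.pos hv _ (by omega) (by omega) (by omega)

/-- A slice to the right of a word is moved above it. -/
theorem word_slice (hu : run m u = some m) (g : Gen) {j : ℕ} (q : Word) (hmj : m ≤ j)
    (hj : j + g.ins ≤ n) :
    WordEq PlanarMove n (u ++ ⟨g, j⟩ :: q) (⟨g, j⟩ :: (u ++ q)) := by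
  refine word_interchange (v := [⟨g, 0⟩]) (b := 0 + g.outs) (a := g.ins) hu ?_ q hmj hj rfl
  simp [run_cons_some, run_nil_iff]

end RationalTangle

/-! ### Planar isotopies relating sums, products, quarter turns and flips. -/

namespace RationalTangle

variable {M : Word → Word → Prop} {n m : ℕ} {u v : Word}

/-! ### Moves at the beginning of a word -/

theorem zigzag_left (i : ℕ) (q : Word) (h : i + 1 ≤ n) :
    WordEq PlanarMove n (cap i :: cup (i + 1) :: q) q := by
  refine WordEq.of_move (l := n) (PlanarMove.zigzag_left i) ?_ rfl q
  simp only [run_cons_some, run_nil_iff, cap, cup, Gen.ins, Gen.outs]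
  omega

theorem zigzag_right (i : ℕ) (q : Word) (h : i + 1 ≤ n) :
    WordEq PlanarMove n (cap (i + 1) :: cup i :: q) q := by
  refine WordEq.of_move (l := n) (PlanarMove.zigzag_right i) ?_ rfl q
  simp only [run_cons_some, run_nil_iff, cap, cup, Gen.ins, Gen.outs]
  omega

theorem cap_cross (ε : Bool) (i : ℕ) (q : Word) (h : i + 1 ≤ n) :
    WordEq PlanarMove n (cap i :: cross ε (i + 1) :: q) (cap (i + 1) :: cross (!ε) i :: q) := by
  refine WordEq.of_move (l := n + 2) (PlanarMove.cap_cross ε i) ?_ ?_ q <;>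
    simp only [run_cons_some, run_nil_iff, cap, cross, Gen.ins, Gen.outs] <;> omega

theorem cup_cross (ε : Bool) (i : ℕ) (q : Word) (h : i + 3 ≤ n) :
    WordEq PlanarMove n (cross ε i :: cup (i + 1) :: q) (cross (!ε) (i + 1) :: cup i :: q) := by
  refine WordEq.of_move (l := n - 2) (PlanarMove.cup_cross ε i) ?_ ?_ q <;>
    simp only [run_cons_some, run_nil_iff, cup, cross, Gen.ins, Gen.outs] <;> omega

theorem cap_curl (ε : Bool) (i : ℕ) (q : Word) (h : i ≤ n) :
    WordEq IsotopyMove n (cap i :: cross ε i :: q) (cap i :: q) := by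
  refine WordEq.of_move (M := IsotopyMove) (l := n + 2)
    (.inr (ReidemeisterMove.one_cap ε i)) ?_ ?_ q <;>
    simp only [run_cons_some, run_nil_iff, cap, cross, Gen.ins, Gen.outs] <;> omega

theorem cup_curl (ε : Bool) (i : ℕ) (q : Word) (h : i + 2 ≤ n) :
    WordEq IsotopyMove n (cross ε i :: cup i :: q) (cup i :: q) := by
  refine WordEq.of_move (M := IsotopyMove) (l := n - 2)
    (.inr (ReidemeisterMove.one_cup ε i)) ?_ ?_ q <;>
    simp only [run_cons_some, run_nil_iff, cup, cross, Gen.ins, Gen.outs] <;> omega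

theorem cross_cancel (ε : Bool) (i : ℕ) (q : Word) (h : i + 2 ≤ n) :
    WordEq IsotopyMove n (cross ε i :: cross (!ε) i :: q) q := by
  refine WordEq.of_move (M := IsotopyMove) (l := n) (.inr (ReidemeisterMove.two ε i)) ?_ rfl q
  simp only [run_cons_some, run_nil_iff, cross, Gen.ins, Gen.outs]
  omega

theorem cross_cancel' (ε : Bool) (i : ℕ) (q : Word) (h : i + 2 ≤ n) :
    WordEq IsotopyMove n (cross (!ε) i :: cross ε i :: q) q := by
  simpa using cross_cancel (!ε) i q h

theorem cross_braid (ε : Bool) (i : ℕ) (q : Word) (h : i + 3 ≤ n) :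
    WordEq IsotopyMove n (cross ε i :: cross ε (i + 1) :: cross ε i :: q)
      (cross ε (i + 1) :: cross ε i :: cross ε (i + 1) :: q) := by
  refine WordEq.of_move (M := IsotopyMove) (l := n) (.inr (ReidemeisterMove.three ε i)) ?_ ?_ q <;>
    simp only [run_cons_some, run_nil_iff, cross, Gen.ins, Gen.outs] <;> omega

/-! ### Subtangles of words -/

theorem run_tangle (T : TwoTangle) (i : ℕ) (h : i + 2 ≤ n) :
    run n (shift i T.word) = some n := by
  obtain ⟨k, rfl⟩ := Nat.exists_eq_add_of_le h
  exact run_shift i k T.wf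

theorem WordEq.tangle (T : TwoTangle) (i : ℕ) (hi : i + 2 ≤ n) (h : WordEq M n u v) :
    WordEq M n (RationalTangle.shift i T.word ++ u) (RationalTangle.shift i T.word ++ v) :=
  .append_left (run_tangle T i hi) h

theorem tangle_interchange (S T : TwoTangle) (i j : ℕ) (q : Word) (hij : i + 2 ≤ j)
    (hj : j + 2 ≤ n) :
    WordEq PlanarMove n (shift i S.word ++ (shift j T.word ++ q))
      (shift j T.word ++ (shift i S.word ++ q)) :=
  word_interchange (run_tangle S i le_rfl) T.wf q hij hj (by omega)

theorem slice_tangle (g : Gen) (T : TwoTangle) (i : ℕ) {j j' : ℕ} (q : Word) (hij : i + g.ins ≤ j)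
    (hj : j + 2 ≤ n) (hj' : j' + g.ins = j + g.outs) :
    WordEq PlanarMove n (⟨g, i⟩ :: (shift j' T.word ++ q)) (shift j T.word ++ ⟨g, i⟩ :: q) :=
  slice_interchange g i T.wf q hij hj hj'

theorem tangle_slice (T : TwoTangle) (g : Gen) (i j : ℕ) (q : Word) (hij : i + 2 ≤ j)
    (hj : j + g.ins ≤ n) :
    WordEq PlanarMove n (shift i T.word ++ ⟨g, j⟩ :: q) (⟨g, j⟩ :: (shift i T.word ++ q)) :=
  word_slice (run_tangle T i le_rfl) g q hij hj

/-! ### Words of sums, products and rotations -/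

namespace TwoTangle

theorem word_add (S T : TwoTangle) : (S + T).word =
    RationalTangle.cap 1 :: (shift 0 S.word ++ (shift 2 T.word ++ [RationalTangle.cup 1])) := by
  rw [shift_zero, ← List.append_assoc]
  rfl

theorem word_mul (S T : TwoTangle) : (S * T).word = S.word ++ T.word := rfl

theorem word_rot (T : TwoTangle) :
    T.rot.word = RationalTangle.cap 0 :: (shift 1 T.word ++ [RationalTangle.cup 2]) := rfl

theorem word_unit (ε : Bool) : (unit ε).word = [RationalTangle.cross ε 0] := rfl

theorem word_hflip (T : TwoTangle) : T.hflip.word = hflipWord T.word := rfl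

theorem word_vflip (T : TwoTangle) : T.vflip.word = vflipWord 2 T.word := rfl

theorem hflipWord_append (u v : Word) : hflipWord (u ++ v) = hflipWord v ++ hflipWord u := by
  simp [hflipWord]

theorem hflipWord_shift (k : ℕ) (w : Word) : hflipWord (shift k w) = shift k (hflipWord w) := by
  simp [hflipWord, shift]

theorem vflipWord_append (hu : run n u = some m) (v : Word) :
    vflipWord n (u ++ v) = vflipWord n u ++ vflipWord m v := by
  induction u generalizing n with
  | nil => obtain rfl := run_nil_iff.1 hu; rfl
  | cons s u ih =>
    simp only [List.cons_append, vflipWord]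
    rw [ih (run_cons_some.1 hu).2]

/-- The `k` additional strands stand to the right of the word and come to stand to its left after
the flip; `vflipWord_shift` is the opposite situation. -/
theorem vflipWord_add (k : ℕ) (hu : run n u = some m) :
    vflipWord (k + n) u = shift k (vflipWord n u) := by
  induction u generalizing n with
  | nil => rfl
  | cons s u ih =>
    obtain ⟨h1, h2⟩ := run_cons_some.1 hu
    simp only [vflipWord, shift_cons]
    rw [← ih h2]
    congr 2
    · omega
    · omega

theorem vflipWord_shift (k : ℕ) (hu : run n u = some m) :
    vflipWord (k + n) (shift k u) = vflipWord n u := by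
  induction u generalizing n with
  | nil => rfl
  | cons s u ih =>
    obtain ⟨h1, h2⟩ := run_cons_some.1 hu
    simp only [vflipWord, shift_cons]
    rw [← ih h2]
    congr 2
    · omega
    · omega

end TwoTangle

/-! ### Congruence -/

namespace WordEq

open TwoTangle

variable {S S' T T' : TwoTangle}

theorem tangle_mul (hS : WordEq M 2 S.word S'.word) (hT : WordEq M 2 T.word T'.word) :
    WordEq M 2 (S * T).word (S' * T').word :=
  (hS.append_right T.word).trans (.append_left S'.wf hT)

theorem tangle_add (hM : Shiftable M) (hS : WordEq M 2 S.word S'.word)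
    (hT : WordEq M 2 T.word T'.word) : WordEq M 2 (S + T).word (S' + T').word := by
  rw [word_add, word_add]
  exact .cons _ (by decide) (((hS.shift hM 0 2).append_right _).trans
    (.tangle _ _ (by decide) ((hT.shift hM 2 0).append_right _)))

theorem tangle_rot (hM : Shiftable M) (hS : WordEq M 2 S.word S'.word) :
    WordEq M 2 S.rot.word S'.rot.word :=
  .cons _ (by decide) ((hS.shift hM 1 1).append_right _)

end WordEq

/-! ### Planar isotopies between sums, products and rotations -/

namespace PlanarIsotopic

open TwoTangle

variable {S S' T T' U : TwoTangle}

theorem refl (S : TwoTangle) : PlanarIsotopic S S := Relation.EqvGen.refl S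

theorem symm (h : PlanarIsotopic S T) : PlanarIsotopic T S := Relation.EqvGen.symm _ _ h

theorem trans (h : PlanarIsotopic S T) (h' : PlanarIsotopic T U) : PlanarIsotopic S U :=
  Relation.EqvGen.trans _ _ _ h h'

theorem add (hS : PlanarIsotopic S S') (hT : PlanarIsotopic T T') :
    PlanarIsotopic (S + T) (S' + T') :=
  planarIsotopic_iff.2 (.tangle_add shiftable_planarMove (planarIsotopic_iff.1 hS)
    (planarIsotopic_iff.1 hT))

theorem mul (hS : PlanarIsotopic S S') (hT : PlanarIsotopic T T') :
    PlanarIsotopic (S * T) (S' * T') :=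
  planarIsotopic_iff.2 (.tangle_mul (planarIsotopic_iff.1 hS) (planarIsotopic_iff.1 hT))

theorem rot (hS : PlanarIsotopic S S') : PlanarIsotopic S.rot S'.rot :=
  planarIsotopic_iff.2 (.tangle_rot shiftable_planarMove (planarIsotopic_iff.1 hS))

/-- A counterclockwise quarter turn carries the right side to the top, so the order of summands is
reversed; it carries the top to the left, so `rot_mul` keeps the order. -/
theorem rot_add (S T : TwoTangle) : PlanarIsotopic (S + T).rot (T.rot * S.rot) := by
  rw [planarIsotopic_iff]
  have h1 : (S + T).rot.word = RationalTangle.cap 0 :: RationalTangle.cap 2 ::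
      (shift 1 S.word ++ (shift 3 T.word ++ [RationalTangle.cup 2, RationalTangle.cup 2])) := by
    rw [word_rot, word_add]
    simp [shift_cons, shift_append, shift_shift, shift_nil, RationalTangle.cap, RationalTangle.cup]
  have h2 : (T.rot * S.rot).word = RationalTangle.cap 0 :: (shift 1 T.word ++
      (RationalTangle.cup 2 :: RationalTangle.cap 0 ::
        (shift 1 S.word ++ [RationalTangle.cup 2]))) := by
    rw [word_mul, word_rot, word_rot]
    simp
  rw [h1, h2]
  have e1 : WordEq PlanarMove 4 (RationalTangle.cup 2 :: RationalTangle.cap 0 ::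
      (shift 1 S.word ++ [RationalTangle.cup 2])) (RationalTangle.cap 0 :: RationalTangle.cup 4 ::
      (shift 1 S.word ++ [RationalTangle.cup 2])) :=
    (interchange .cap .cup 0 _ (by decide) (by decide) (by decide)).symm
  refine .symm (.trans (.cons _ (by decide) (.tangle _ _ (by decide) e1)) ?_)
  refine .trans (.cons _ (by decide) (slice_tangle .cap T 0 (j' := 3) _ (by decide) (by decide)
    (by decide)).symm) ?_
  refine .trans (interchange .cap .cap 0 (j' := 2) _ (by decide) (by decide) (by decide)).symm ?_
  refine .cons _ (by decide) (.cons _ (by decide) ?_)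
  refine .trans (.tangle _ _ (by decide) (tangle_slice S .cup 1 4 _ (by decide) (by decide)).symm) ?_
  refine .trans (tangle_interchange S T 1 3 _ (by decide) (by decide)).symm ?_
  refine .tangle _ _ (by decide) (.tangle _ _ (by decide) ?_)
  exact (interchange .cup .cup 2 _ (by decide) (by decide) (by decide)).symm

theorem rot_mul (S T : TwoTangle) : PlanarIsotopic (S * T).rot (S.rot + T.rot) := by
  rw [planarIsotopic_iff]
  have h1 : (S * T).rot.word = RationalTangle.cap 0 ::
      (shift 1 S.word ++ (shift 1 T.word ++ [RationalTangle.cup 2])) := by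
    rw [word_rot, word_mul]
    simp [shift_append]
  have h2 : (S.rot + T.rot).word = RationalTangle.cap 1 :: RationalTangle.cap 0 ::
      (shift 1 S.word ++ (RationalTangle.cup 2 :: RationalTangle.cap 2 ::
        (shift 3 T.word ++ [RationalTangle.cup 4, RationalTangle.cup 1]))) := by
    rw [word_add, word_rot, word_rot]
    simp [shift_cons, shift_append, shift_shift, shift_nil, RationalTangle.cap, RationalTangle.cup]
  rw [h1, h2]
  refine .symm (.trans (interchange .cap .cap 0 (j' := 3) _ (by decide) (by decide)
    (by decide)).symm ?_)
  refine .cons _ (by decide) ?_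
  refine .trans (tangle_slice S .cap 1 3 _ (by decide) (by decide)).symm ?_
  refine .tangle _ _ (by decide) ?_
  refine .trans (zigzag_right 2 _ (by decide)) ?_
  refine .trans (.cons _ (by decide) (.tangle _ _ (by decide)
    (interchange .cup .cup 1 (j' := 2) _ (by decide) (by decide) (by decide)).symm)) ?_
  refine .trans (.cons _ (by decide)
    (slice_tangle .cup T 1 (j' := 1) _ (by decide) (by decide) (by decide)).symm) ?_
  exact zigzag_right 1 _ (by decide)

theorem rot_unit (ε : Bool) : PlanarIsotopic (unit ε).rot (unit (!ε)) := by
  rw [planarIsotopic_iff]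
  refine .trans (cap_cross ε 0 _ (by decide)) ?_
  refine .trans (.cons _ (by decide)
    (interchange (.cross (!ε)) .cup 0 (j := 2) _ le_rfl (by decide) rfl)) ?_
  exact zigzag_left 1 _ (by decide)

theorem rot_zero : PlanarIsotopic zero.rot infty := by
  rw [planarIsotopic_iff]
  exact .trans (zigzag_left 0 _ (by decide)) (zigzag_left 1 _ (by decide))

theorem rot_infty : PlanarIsotopic infty.rot zero := by
  rw [planarIsotopic_iff]
  exact interchange .cap .cup 0 _ (by decide) (by decide) (by decide)

theorem add_assoc (S T U : TwoTangle) : PlanarIsotopic (S + T + U) (S + (T + U)) := by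
  rw [planarIsotopic_iff]
  have h1 : (S + T + U).word = RationalTangle.cap 1 :: RationalTangle.cap 1 ::
      (shift 0 S.word ++ (shift 2 T.word ++ (RationalTangle.cup 1 ::
        (shift 2 U.word ++ [RationalTangle.cup 1])))) := by
    rw [word_add, word_add]
    simp [shift_cons, shift_append, shift_shift, shift_nil, RationalTangle.cap, RationalTangle.cup]
  have h2 : (S + (T + U)).word = RationalTangle.cap 1 ::
      (shift 0 S.word ++ (RationalTangle.cap 3 :: (shift 2 T.word ++
        (shift 4 U.word ++ [RationalTangle.cup 3, RationalTangle.cup 1])))) := by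
    rw [word_add, word_add]
    simp [shift_cons, shift_append, shift_shift, shift_nil, RationalTangle.cap, RationalTangle.cup]
  rw [h1, h2]
  refine .trans ?_ (.cons _ (by decide) (tangle_slice S .cap 0 3 _ (by decide) (by decide)).symm)
  refine .trans (interchange .cap .cap 1 (j' := 3) _ (by decide) (by decide) (by decide)).symm ?_
  refine .cons _ (by decide) (.cons _ (by decide) (.tangle _ _ (by decide)
    (.tangle _ _ (by decide) ?_)))
  refine .trans (slice_tangle .cup U 1 (j := 4) _ (by decide) (by decide) (by decide)) ?_
  refine .tangle _ _ (by decide) ?_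
  exact interchange .cup .cup 1 _ (by decide) (by decide) (by decide)

theorem mul_assoc (S T U : TwoTangle) : S * T * U = S * (T * U) :=
  TwoTangle.ext (List.append_assoc _ _ _)

theorem zero_add (T : TwoTangle) : PlanarIsotopic (zero + T) T := by
  rw [planarIsotopic_iff, word_add]
  refine .trans (zigzag_right 0 _ (by decide)) ?_
  refine .trans (slice_tangle .cap T 0 (j := 0) _ (by decide) (by decide) (by decide)) ?_
  have := WordEq.tangle T 0 le_rfl (zigzag_left (n := 2) 0 [] (by decide))
  rw [List.append_nil] at this
  rw [shift_zero] at this ⊢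
  exact this

theorem add_zero (T : TwoTangle) : PlanarIsotopic (T + zero) T := by
  rw [planarIsotopic_iff, word_add]
  refine .trans (.cons _ (by decide) (.tangle _ _ (by decide) (.cons _ (by decide)
    (zigzag_right 1 _ (by decide))))) ?_
  refine .trans (.cons _ (by decide) (tangle_slice T .cup 0 2 _ (by decide) (by decide))) ?_
  refine .trans (zigzag_left 1 _ (by decide)) ?_
  rw [List.append_nil, shift_zero]
  exact .refl _

theorem hflip_add (S T : TwoTangle) : PlanarIsotopic (S + T).hflip (S.hflip + T.hflip) := by
  rw [planarIsotopic_iff]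
  have h1 : (S + T).hflip.word = RationalTangle.cap 1 :: (shift 2 T.hflip.word ++
      (shift 0 S.hflip.word ++ [RationalTangle.cup 1])) := by
    rw [word_hflip, word_add, word_hflip, word_hflip, ← hflipWord_shift, ← hflipWord_shift,
      ← List.singleton_append, hflipWord_append, hflipWord_append, hflipWord_append]
    simp only [List.append_assoc]
    rfl
  rw [h1, word_add]
  exact .cons _ (by decide) (tangle_interchange S.hflip T.hflip 0 2 _ (by decide) (by decide)).symm

theorem hflip_mul (S T : TwoTangle) : (S * T).hflip = T.hflip * S.hflip :=
  TwoTangle.ext (hflipWord_append _ _)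

theorem vflip_add (S T : TwoTangle) : PlanarIsotopic (S + T).vflip (T.vflip + S.vflip) := by
  rw [planarIsotopic_iff]
  have h1 : (S + T).vflip.word = RationalTangle.cap 1 :: (shift 2 S.vflip.word ++
      (shift 0 T.vflip.word ++ [RationalTangle.cup 1])) := by
    rw [word_vflip, word_add, shift_zero, shift_zero]
    change RationalTangle.cap 1 :: vflipWord 4 _ = _
    have hS : run 4 S.word = some 4 := by simpa [shift_zero] using run_tangle S (n := 4) 0
    rw [vflipWord_append hS, vflipWord_append (run_tangle T 2 le_rfl),
      vflipWord_add (n := 2) 2 S.wf, vflipWord_shift (n := 2) 2 T.wf]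
    rfl
  rw [h1, word_add]
  exact .cons _ (by decide) (tangle_interchange T.vflip S.vflip 0 2 _ (by decide) (by decide)).symm

theorem vflip_mul (S T : TwoTangle) : (S * T).vflip = S.vflip * T.vflip :=
  TwoTangle.ext (vflipWord_append S.wf _)

end PlanarIsotopic

end RationalTangle

/-! ### Pulling a half twist through an arbitrary word. -/

namespace RationalTangle

variable {n m : ℕ} {u v w : Word}

/-! ### The half twist -/

/-- The strand with `n` strands to its left passes to the left of all of them. -/
def passLeft (ε : Bool) : ℕ → Word
  | 0 => []
  | n + 1 => cross ε n :: passLeft ε n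

/-- The half twist of `n` strands. -/
def halfTwist (ε : Bool) : ℕ → Word
  | 0 => []
  | n + 1 => halfTwist ε n ++ passLeft ε n

theorem run_passLeft (ε : Bool) {N : ℕ} (h : n + 1 ≤ N) : run N (passLeft ε n) = some N := by
  induction n with
  | zero => rfl
  | succ n ih =>
    refine run_cons_some.2 ⟨h, ?_⟩
    rw [show N - (cross ε n).gen.ins + (cross ε n).gen.outs = N by
      simp only [cross, Gen.ins, Gen.outs]; omega]
    exact ih (by omega)

theorem run_halfTwist (ε : Bool) {N : ℕ} (h : n ≤ N) : run N (halfTwist ε n) = some N := by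
  induction n with
  | zero => rfl
  | succ n ih => rw [halfTwist, run_append, ih (by omega), Option.bind_some, run_passLeft ε h]

theorem WordEq.cross_cons {M : Word → Word → Prop} (ε : Bool) (i : ℕ) (hi : i + 2 ≤ n)
    (h : WordEq M n u v) : WordEq M n (cross ε i :: u) (cross ε i :: v) := by
  refine .cons _ hi ?_
  rwa [show n - (cross ε i).gen.ins + (cross ε i).gen.outs = n by
    simp only [cross, Gen.ins, Gen.outs]; omega]

/-- A crossing is pulled below the strand that passes over or under it from the right. -/
theorem cross_slide_right (δ ε : Bool) (i : ℕ) (q : Word) (h : i + 3 ≤ n) :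
    WordEq IsotopyMove n (cross δ i :: cross ε (i + 1) :: cross ε i :: q)
      (cross ε (i + 1) :: cross ε i :: cross δ (i + 1) :: q) := by
  rcases eq_or_ne δ ε with rfl | hδ
  · exact cross_braid δ i q h
  · obtain rfl : δ = !ε := by cases δ <;> cases ε <;> simp_all
    -- The third Reidemeister move with mixed crossings follows by conjugation: a cancelling pair is
    -- inserted below, the move with equal crossings is applied backwards, and a cancelling pair
    -- appears on top.
    refine .trans (.cross_cons _ _ (by omega) (.cross_cons _ _ (by omega) (.cross_cons _ _
      (by omega) (cross_cancel ε (i + 1) q (by omega)).symm))) ?_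
    refine .trans (.cross_cons _ _ (by omega) (cross_braid ε i _ h).symm) ?_
    exact cross_cancel' ε i _ (by omega)

/-- A crossing is pulled above the strand that passes over or under it from the left. -/
theorem cross_slide_left (δ ε : Bool) (i : ℕ) (q : Word) (h : i + 3 ≤ n) :
    WordEq IsotopyMove n (cross ε i :: cross ε (i + 1) :: cross δ i :: q)
      (cross δ (i + 1) :: cross ε i :: cross ε (i + 1) :: q) := by
  rcases eq_or_ne δ ε with rfl | hδ
  · exact cross_braid δ i q h
  · obtain rfl : δ = !ε := by cases δ <;> cases ε <;> simp_all
    refine .trans (cross_cancel' ε (i + 1) _ (by omega)).symm ?_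
    refine .trans (.cross_cons _ _ (by omega) (cross_braid ε i _ h).symm) ?_
    exact .cross_cons _ _ (by omega) (.cross_cons _ _ (by omega) (.cross_cons _ _ (by omega)
      (cross_cancel ε i q (by omega))))

theorem cross_comm (δ ε : Bool) (i : ℕ) (q : Word) (h : i + 2 ≤ n) :
    WordEq IsotopyMove n (cross ε i :: cross δ i :: q) (cross δ i :: cross ε i :: q) := by
  rcases eq_or_ne δ ε with rfl | hδ
  · exact .refl _
  · obtain rfl : δ = !ε := by cases δ <;> cases ε <;> simp_all
    exact (cross_cancel ε i q h).trans (cross_cancel' ε i q h).symm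

theorem passLeft_slice (ε : Bool) (g : Gen) {i j : ℕ} (q : Word) (hij : i + 1 ≤ j)
    (hj : j + g.ins ≤ n) :
    WordEq IsotopyMove n (passLeft ε i ++ ⟨g, j⟩ :: q) (⟨g, j⟩ :: (passLeft ε i ++ q)) :=
  .of_planar (word_slice (run_passLeft ε le_rfl) g q hij hj)

/-- A slice is pulled below the strand that passes over or under it from the right. -/
theorem slice_passLeft (ε : Bool) (g : Gen) (i r : ℕ) (q : Word) (h : i + g.ins + r + 1 ≤ n) :
    WordEq IsotopyMove n (⟨g, i⟩ :: (passLeft ε (i + g.outs + r) ++ q))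
      (passLeft ε (i + g.ins + r) ++ ⟨g, i + 1⟩ :: q) := by
  induction r with
  | zero =>
    cases g with
    | cap =>
      refine .trans (.of_planar (cap_cross ε i _ ?_)) ?_
      · simpa [Gen.ins] using h
      refine .trans (.cons _ ?_ (cross_cancel' ε i _ ?_)) ?_
      · simpa [cap, Gen.ins] using h
      · simp only [cap, Gen.ins, Gen.outs] at h ⊢; omega
      exact (passLeft_slice ε .cap q le_rfl h).symm
    | cup =>
      have h' : i + 3 ≤ n := h
      refine .trans (cross_cancel ε (i + 1) _ h').symm ?_
      refine .cross_cons _ _ h' (.trans (.of_planar (cup_cross ε i _ h').symm) ?_)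
      exact .cross_cons _ _ (by omega) (passLeft_slice ε .cup q le_rfl h').symm
    | cross δ =>
      have h' : i + 3 ≤ n := h
      refine .trans (cross_slide_right δ ε i _ h') ?_
      exact .cross_cons _ _ h' (.cross_cons _ _ (by omega)
        (passLeft_slice ε (.cross δ) q le_rfl h').symm)
  | succ r ih =>
    refine .trans (.of_planar (interchange g (.cross ε) i (j := i + g.ins + r)
      (j' := i + g.outs + r) _ (by omega) ?_ (by omega))) ?_
    · simp only [Gen.ins] at h ⊢; omega
    · exact .cross_cons ε (i + g.ins + r) (by omega) (ih (by omega))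

/-- Two parallel strands with `n` strands to their left pass to the left of all of them. -/
def passLeftTwo (ε : Bool) : ℕ → Word
  | 0 => []
  | n + 1 => cross ε n :: cross ε (n + 1) :: passLeftTwo ε n

/-- The second strand also has to cross the first; this crossing is postponed until both have
arrived at the left, so that the two travel as a parallel band. -/
theorem wordEq_passLeftTwo (ε : Bool) {N : ℕ} (q : Word) (h : n + 2 ≤ N) :
    WordEq IsotopyMove N (passLeft ε n ++ (passLeft ε (n + 1) ++ q))
      (passLeftTwo ε n ++ cross ε 0 :: q) := by
  induction n with
  | zero => exact .refl _
  | succ n ih =>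
    refine .cross_cons _ _ (by omega) ?_
    refine .trans (passLeft_slice ε (.cross ε) _ le_rfl (by simpa [Gen.ins] using h)) ?_
    exact .cross_cons _ _ (by omega) (ih (by omega))

/-- A band closed off by a minimum retracts across one strand after another: one crossing is turned
over the minimum and then cancels the other. -/
theorem passLeftTwo_cup (ε : Bool) {N : ℕ} (q : Word) (h : n + 2 ≤ N) :
    WordEq IsotopyMove N (passLeftTwo ε n ++ cup 0 :: q) (cup n :: q) := by
  induction n with
  | zero => exact .refl _
  | succ n ih =>
    refine .trans (.cross_cons _ _ (by omega) (.cross_cons _ _ (by omega) (ih (by omega)))) ?_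
    refine .trans (.cross_cons _ _ (by omega) (.of_planar ?_))
      (cross_cancel ε n _ (by omega))
    simpa using (cup_cross (!ε) n q (by omega)).symm

theorem cap_passLeftTwo (ε : Bool) {N : ℕ} (q : Word) (h : n ≤ N) :
    WordEq IsotopyMove N (cap n :: (passLeftTwo ε n ++ q)) (cap 0 :: q) := by
  induction n with
  | zero => exact .refl _
  | succ n ih =>
    refine .trans ?_ (ih (by omega))
    have : WordEq IsotopyMove N (cap (n + 1) :: cross ε n :: cross ε (n + 1) ::
        (passLeftTwo ε n ++ q)) (cap n :: cross (!ε) (n + 1) :: cross ε (n + 1) ::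
        (passLeftTwo ε n ++ q)) := by
      refine .of_planar ?_
      simpa using (cap_cross (!ε) n (cross ε (n + 1) :: (passLeftTwo ε n ++ q)) h).symm
    refine .trans this (.cons _ ?_ (cross_cancel' ε (n + 1) _ ?_)) <;>
      simp only [cap, Gen.ins, Gen.outs] <;> omega

theorem passLeftTwo_cross (ε δ : Bool) {N : ℕ} (q : Word) (h : n + 2 ≤ N) :
    WordEq IsotopyMove N (passLeftTwo ε n ++ cross δ 0 :: q)
      (cross δ n :: (passLeftTwo ε n ++ q)) := by
  induction n with
  | zero => exact .refl _
  | succ n ih =>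
    refine .trans (.cross_cons _ _ (by omega) (.cross_cons _ _ (by omega) (ih (by omega)))) ?_
    exact cross_slide_left δ ε n _ h

theorem run_passLeftTwo (ε : Bool) {N : ℕ} (h : n + 2 ≤ N) :
    run N (passLeftTwo ε n) = some N := by
  induction n with
  | zero => rfl
  | succ n ih =>
    refine run_cons_some.2 ⟨by simp only [cross, Gen.ins]; omega, run_cons_some.2 ⟨?_, ?_⟩⟩
    · simp only [cross, Gen.ins, Gen.outs]; omega
    · rw [← ih (by omega)]
      congr 1
      simp only [cross, Gen.ins, Gen.outs]; omega

theorem halfTwist_add_two (ε : Bool) {N : ℕ} (q : Word) (h : n + 2 ≤ N) :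
    WordEq IsotopyMove N (halfTwist ε (n + 2) ++ q)
      (halfTwist ε n ++ (passLeftTwo ε n ++ cross ε 0 :: q)) := by
  simp only [halfTwist, List.append_assoc]
  exact .append_left (run_halfTwist ε (by omega)) (wordEq_passLeftTwo ε q h)

/-- A slice above which there is a half twist is flipped and moved above the half twist. -/
theorem halfTwist_slice (ε : Bool) (g : Gen) (i r : ℕ) {N : ℕ} (q : Word)
    (h : i + g.ins + r ≤ N) :
    WordEq IsotopyMove N (halfTwist ε (i + g.ins + r) ++ ⟨g, i⟩ :: q)
      (⟨g, r⟩ :: (halfTwist ε (i + g.outs + r) ++ q)) := by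
  induction i generalizing N q with
  | zero =>
    have hr : run r (halfTwist ε r) = some r := run_halfTwist ε le_rfl
    have hN : run N (halfTwist ε r) = some N := run_halfTwist ε (by omega)
    simp only [zero_add] at h ⊢
    rw [add_comm g.outs, add_comm g.ins] at *
    have hs : WordEq IsotopyMove N (halfTwist ε r ++ ⟨g, r⟩ :: q)
        (⟨g, r⟩ :: (halfTwist ε r ++ q)) := .of_planar (word_slice hr g q le_rfl h)
    -- The two rightmost strands reach `g` as a band with a single crossing just above it. A maximum
    -- or minimum absorbs that crossing as a curl and then slides along the band; a crossing
    -- commutes with it and then slides. The maximum is treated from the other side, where the band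
    -- starts below it.
    cases g with
    | cap =>
      refine .symm (.trans (.cons _ h (halfTwist_add_two ε q ?_)) ?_)
      · simp only [Gen.ins, Gen.outs] at h ⊢; omega
      refine .trans (.of_planar (word_slice hr .cap _ le_rfl h).symm) (.append_left hN ?_)
      exact (cap_passLeftTwo ε _ h).trans (cap_curl ε 0 q (by omega))
    | cup =>
      refine .trans (halfTwist_add_two ε _ h) (.trans (.append_left hN ?_) hs)
      refine .trans (.append_left (run_passLeftTwo ε h) (cup_curl ε 0 q ?_))
        (passLeftTwo_cup ε q h)
      simp only [Gen.ins] at h; omega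
    | cross δ =>
      have h2 : 0 + 2 ≤ N := by simp only [Gen.ins] at h; omega
      refine .trans (halfTwist_add_two ε _ h) ?_
      refine .trans (.append_left hN ((WordEq.append_left (run_passLeftTwo ε h)
        (cross_comm δ ε 0 q h2)).trans (passLeftTwo_cross ε δ _ h))) ?_
      refine .trans (.of_planar (word_slice hr (.cross δ) _ le_rfl h)) ?_
      exact .cross_cons _ _ h (halfTwist_add_two ε q h).symm
  | succ i ih =>
    have e1 : i + 1 + g.ins + r = i + g.ins + r + 1 := by omega
    have e2 : i + 1 + g.outs + r = i + g.outs + r + 1 := by omega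
    rw [e1, e2]
    rw [e1] at h
    simp only [halfTwist, List.append_assoc]
    refine .trans (.append_left (run_halfTwist ε (by omega))
      (slice_passLeft ε g i r q h).symm) ?_
    exact ih _ (by omega)

/-- A word above which there is a half twist is flipped and moved above the half twist. -/
theorem halfTwist_word (ε : Bool) {N : ℕ} (hw : run n w = some m) (q : Word) (h : n ≤ N) :
    WordEq IsotopyMove N (halfTwist ε n ++ (w ++ q)) (vflipWord n w ++ (halfTwist ε m ++ q)) := by
  induction w generalizing n N with
  | nil => obtain rfl := run_nil_iff.1 hw; exact .refl _
  | cons s w ih =>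
    obtain ⟨h1, h2⟩ := run_cons_some.1 hw
    obtain ⟨r, hr⟩ := Nat.exists_eq_add_of_le h1
    have e : n - s.gen.ins + s.gen.outs = s.pos + s.gen.outs + r := by omega
    have := halfTwist_slice ε s.gen s.pos r (w ++ q) (hr ▸ h)
    rw [← hr, ← e] at this
    simp only [vflipWord]
    rw [show n - s.gen.ins - s.pos = r by omega]
    refine .trans this (.cons _ ?_ (ih h2 (by simp only; omega)))
    simp only; omega

end RationalTangle

/-! ### Flypes, transfer moves and untwistings as isotopies. -/

namespace RationalTangle

open TwoTangle

variable {S S' T T' U : TwoTangle}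

namespace Isotopic

theorem refl (S : TwoTangle) : Isotopic S S := Relation.EqvGen.refl S

theorem symm (h : Isotopic S T) : Isotopic T S := Relation.EqvGen.symm _ _ h

theorem trans (h : Isotopic S T) (h' : Isotopic T U) : Isotopic S U :=
  Relation.EqvGen.trans _ _ _ h h'

theorem add (hS : Isotopic S S') (hT : Isotopic T T') : Isotopic (S + T) (S' + T') :=
  isotopic_iff.2 (.tangle_add shiftable_isotopyMove (isotopic_iff.1 hS) (isotopic_iff.1 hT))

theorem mul (hS : Isotopic S S') (hT : Isotopic T T') : Isotopic (S * T) (S' * T') :=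
  isotopic_iff.2 (.tangle_mul (isotopic_iff.1 hS) (isotopic_iff.1 hT))

theorem rot (hS : Isotopic S S') : Isotopic S.rot S'.rot :=
  isotopic_iff.2 (.tangle_rot shiftable_isotopyMove (isotopic_iff.1 hS))

end Isotopic

theorem PlanarIsotopic.isotopic (h : PlanarIsotopic S T) : Isotopic S T :=
  isotopic_iff.2 (.of_planar (planarIsotopic_iff.1 h))

/-! ### Flips -/

/-- The flip reverses the order of slices, so some moves turn into inverses of moves. -/
theorem planarMove_hflip {x y : Word} (h : PlanarMove x y) :
    PlanarMove (hflipWord x) (hflipWord y) ∨ PlanarMove (hflipWord y) (hflipWord x) := by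
  cases h with
  | interchange g h i k =>
    right
    have := PlanarMove.interchange g.hflip h.hflip i k
    have e1 : g.hflip.outs = g.ins := by cases g <;> rfl
    have e2 : g.hflip.ins = g.outs := by cases g <;> rfl
    rw [e1, e2] at this
    exact this
  | zigzag_left i => exact .inl (.zigzag_right i)
  | zigzag_right i => exact .inl (.zigzag_left i)
  | cap_cross ε i =>
    have := PlanarMove.cup_cross (!ε) i
    rw [Bool.not_not] at this
    exact .inr this
  | cup_cross ε i =>
    have := PlanarMove.cap_cross (!ε) i
    rw [Bool.not_not] at this
    exact .inr this

theorem reidemeisterMove_hflip {x y : Word} (h : ReidemeisterMove x y) :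
    ReidemeisterMove (hflipWord x) (hflipWord y) := by
  cases h with
  | one_cap ε i => exact .one_cup ε i
  | one_cup ε i => exact .one_cap ε i
  | two ε i =>
    have := ReidemeisterMove.two (!ε) i
    rw [Bool.not_not] at this
    exact this
  | three ε i => exact .three ε i

theorem eqvGen_hflip {M : Word → Word → Prop}
    (hM : ∀ x y, M x y → M (hflipWord x) (hflipWord y) ∨ M (hflipWord y) (hflipWord x))
    (h : Relation.EqvGen (LocalStep M) S T) :
    Relation.EqvGen (LocalStep M) S.hflip T.hflip := by
  induction h with
  | rel S T h =>
    obtain ⟨p, q, x, y, h, hS, hT⟩ := h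
    have hS' : S.hflip.word = hflipWord q ++ hflipWord x ++ hflipWord p := by
      rw [word_hflip, hS, hflipWord_append, hflipWord_append, List.append_assoc]
    have hT' : T.hflip.word = hflipWord q ++ hflipWord y ++ hflipWord p := by
      rw [word_hflip, hT, hflipWord_append, hflipWord_append, List.append_assoc]
    rcases hM x y h with h | h
    · exact .rel _ _ ⟨_, _, _, _, h, hS', hT'⟩
    · exact .symm _ _ (.rel _ _ ⟨_, _, _, _, h, hT', hS'⟩)
  | refl x => exact .refl _
  | symm x y _ ih => exact .symm _ _ ih
  | trans x y z _ _ ih ih' => exact .trans _ _ _ ih ih'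

theorem PlanarIsotopic.hflip (h : PlanarIsotopic S T) : PlanarIsotopic S.hflip T.hflip :=
  eqvGen_hflip (fun _ _ => planarMove_hflip) h

theorem Isotopic.hflip (h : Isotopic S T) : Isotopic S.hflip T.hflip := by
  refine eqvGen_hflip (fun x y h => ?_) h
  rcases h with h | h
  · exact (planarMove_hflip h).imp .inl .inl
  · exact .inl (.inr (reidemeisterMove_hflip h))

theorem hflip_hflip (T : TwoTangle) : T.hflip.hflip = T := by
  refine TwoTangle.ext ?_
  have : ∀ s : Slice, (⟨s.gen.hflip.hflip, s.pos⟩ : Slice) = s := by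
    rintro ⟨g, i⟩
    cases g <;> rfl
  simp [word_hflip, hflipWord, Function.comp_def, this]

theorem vflipWord_vflipWord {n m : ℕ} {w : Word} (h : run n w = some m) :
    vflipWord n (vflipWord n w) = w := by
  induction w generalizing n with
  | nil => rfl
  | cons s w ih =>
    obtain ⟨h1, h2⟩ := run_cons_some.1 h
    simp only [vflipWord, ih h2]
    congr 2
    omega

theorem vflip_vflip (T : TwoTangle) : T.vflip.vflip = T :=
  TwoTangle.ext (vflipWord_vflipWord T.wf)

/-! ### Rotations of tangles in twist form -/

/-- Every twist form is a quarter turn of another one, so statements about horizontal twists can be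
obtained by rotating statements about vertical ones. -/
theorem TwistForm.exists_rot (h : TwistForm S) : ∃ S', TwistForm S' ∧ PlanarIsotopic S'.rot S := by
  have hu (ε : Bool) : PlanarIsotopic (unit (!ε)).rot (unit ε) := by
    simpa using PlanarIsotopic.rot_unit (!ε)
  induction h with
  | zero => exact ⟨_, .infty, .rot_infty⟩
  | infty => exact ⟨_, .zero, .rot_zero⟩
  | add_right ε _ ih =>
    obtain ⟨S', h, h'⟩ := ih
    exact ⟨_, h.mul_bottom (!ε), (PlanarIsotopic.rot_mul _ _).trans (h'.add (hu ε))⟩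
  | add_left ε _ ih =>
    obtain ⟨S', h, h'⟩ := ih
    exact ⟨_, h.mul_top (!ε), (PlanarIsotopic.rot_mul _ _).trans ((hu ε).add h')⟩
  | mul_bottom ε _ ih =>
    obtain ⟨S', h, h'⟩ := ih
    exact ⟨_, h.add_left (!ε), (PlanarIsotopic.rot_add _ _).trans (h'.mul (hu ε))⟩
  | mul_top ε _ ih =>
    obtain ⟨S', h, h'⟩ := ih
    exact ⟨_, h.add_right (!ε), (PlanarIsotopic.rot_add _ _).trans ((hu ε).mul h')⟩

theorem TwistForm.rot (h : TwistForm S) : ∃ R, TwistForm R ∧ PlanarIsotopic S.rot R := by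
  have hu := PlanarIsotopic.rot_unit
  induction h with
  | zero => exact ⟨_, .infty, .rot_zero⟩
  | infty => exact ⟨_, .zero, .rot_infty⟩
  | add_right ε _ ih =>
    obtain ⟨R, h, h'⟩ := ih
    exact ⟨_, h.mul_top (!ε), (PlanarIsotopic.rot_add _ _).trans ((hu ε).mul h')⟩
  | add_left ε _ ih =>
    obtain ⟨R, h, h'⟩ := ih
    exact ⟨_, h.mul_bottom (!ε), (PlanarIsotopic.rot_add _ _).trans (h'.mul (hu ε))⟩
  | mul_bottom ε _ ih =>
    obtain ⟨R, h, h'⟩ := ih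
    exact ⟨_, h.add_right (!ε), (PlanarIsotopic.rot_mul _ _).trans (h'.add (hu ε))⟩
  | mul_top ε _ ih =>
    obtain ⟨R, h, h'⟩ := ih
    exact ⟨_, h.add_left (!ε), (PlanarIsotopic.rot_mul _ _).trans ((hu ε).add h')⟩

/-- A quarter turn exchanges the two flip axes. Induction over the twist form replaces an argument
about arbitrary words. -/
theorem TwistForm.rot_vflip (h : TwistForm S) : PlanarIsotopic S.vflip.rot S.rot.hflip := by
  have hu := PlanarIsotopic.rot_unit
  induction h with
  | zero => exact PlanarIsotopic.rot_zero.trans PlanarIsotopic.rot_zero.hflip.symm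
  | infty => exact PlanarIsotopic.rot_infty.trans PlanarIsotopic.rot_infty.hflip.symm
  | @add_right T ε _ ih =>
    refine .trans (.trans (PlanarIsotopic.vflip_add T (unit ε)).rot
      ((PlanarIsotopic.rot_add _ _).trans (ih.mul (hu ε)))) (.symm ?_)
    refine ((PlanarIsotopic.rot_add _ _).trans ((hu ε).mul (.refl T.rot))).hflip.trans ?_
    rw [PlanarIsotopic.hflip_mul]
    exact .refl _
  | @add_left T ε _ ih =>
    refine .trans (.trans (PlanarIsotopic.vflip_add (unit ε) T).rot
      ((PlanarIsotopic.rot_add _ _).trans ((hu ε).mul ih))) (.symm ?_)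
    refine ((PlanarIsotopic.rot_add _ _).trans ((PlanarIsotopic.refl T.rot).mul (hu ε))).hflip.trans ?_
    rw [PlanarIsotopic.hflip_mul]
    exact .refl _
  | @mul_bottom T ε _ ih =>
    rw [PlanarIsotopic.vflip_mul]
    refine .trans ((PlanarIsotopic.rot_mul _ _).trans (ih.add (hu ε))) (.symm ?_)
    exact ((PlanarIsotopic.rot_mul _ _).trans ((PlanarIsotopic.refl T.rot).add (hu ε))).hflip.trans
      (PlanarIsotopic.hflip_add _ _)
  | @mul_top T ε _ ih =>
    rw [PlanarIsotopic.vflip_mul]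
    refine .trans ((PlanarIsotopic.rot_mul _ _).trans ((hu ε).add ih)) (.symm ?_)
    exact ((PlanarIsotopic.rot_mul _ _).trans ((hu ε).add (.refl T.rot))).hflip.trans
      (PlanarIsotopic.hflip_add _ _)

/-! ### Flypes -/

/-- The half twist of two strands is a single crossing, so this is `halfTwist_word` for a word with
two strands at either end. -/
theorem isotopic_flype_down (ε : Bool) (t : TwoTangle) :
    Isotopic (unit ε * t) (t.vflip * unit ε) := by
  have := halfTwist_word ε t.wf [] le_rfl
  rw [List.append_nil, List.append_nil] at this
  exact isotopic_iff.2 this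

theorem isotopic_flype_up (ε : Bool) (t : TwoTangle) :
    Isotopic (t * unit ε) (unit ε * t.vflip) := by
  have := (isotopic_flype_down ε t.vflip).symm
  rwa [vflip_vflip] at this

theorem TwistForm.isotopic_flype_right (h : TwistForm S) (ε : Bool) :
    Isotopic (unit ε + S) (S.hflip + unit ε) := by
  obtain ⟨S', h', e⟩ := h.exists_rot
  have hu : PlanarIsotopic (unit (!ε)).rot (unit ε) := by
    simpa using PlanarIsotopic.rot_unit (!ε)
  have h1 : PlanarIsotopic (unit ε + S) (unit (!ε) * S').rot :=
    (hu.symm.add e.symm).trans (PlanarIsotopic.rot_mul _ _).symm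
  have h2 : PlanarIsotopic (S'.vflip * unit (!ε)).rot (S.hflip + unit ε) :=
    (PlanarIsotopic.rot_mul _ _).trans ((h'.rot_vflip.trans e.hflip).add hu)
  exact h1.isotopic.trans ((isotopic_flype_down (!ε) S').rot.trans h2.isotopic)

theorem IsRational.isotopic_flype_right (h : IsRational T) (ε : Bool) :
    Isotopic (unit ε + T) (T.hflip + unit ε) := by
  obtain ⟨S, hS, e⟩ := h
  exact ((Isotopic.refl _).add e).trans
    ((hS.isotopic_flype_right ε).trans (e.hflip.symm.add (.refl _)))

theorem IsRational.isotopic_flype_left (h : IsRational T) (ε : Bool) :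
    Isotopic (T + unit ε) (unit ε + T.hflip) := by
  have h1 := (PlanarIsotopic.hflip_add (unit ε) T).isotopic
  have h2 := (PlanarIsotopic.hflip_add T.hflip (unit ε)).isotopic
  rw [hflip_hflip] at h2
  exact h2.symm.trans ((h.isotopic_flype_right ε).hflip.symm.trans h1)

theorem Flype.isotopic (h : Flype S T) : Isotopic S T := by
  cases h with
  | right ε t h => exact h.isotopic_flype_right ε
  | left ε t h => exact h.isotopic_flype_left ε
  | down ε t _ => exact isotopic_flype_down ε t
  | up ε t _ => exact isotopic_flype_up ε t

/-! ### Twists on any side -/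

/-- An addition of or a multiplication by `[±1]` on any side. -/
inductive IsTwist : (TwoTangle → TwoTangle) → Prop
  | add_right (ε : Bool) : IsTwist (· + unit ε)
  | add_left (ε : Bool) : IsTwist (unit ε + ·)
  | mul_bottom (ε : Bool) : IsTwist (· * unit ε)
  | mul_top (ε : Bool) : IsTwist (unit ε * ·)

section IsTwist

variable {f : TwoTangle → TwoTangle}

theorem IsTwist.planarIsotopic (hf : IsTwist f) (h : PlanarIsotopic S T) :
    PlanarIsotopic (f S) (f T) := by
  cases hf with
  | add_right ε => exact h.add (.refl _)
  | add_left ε => exact .add (.refl _) h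
  | mul_bottom ε => exact h.mul (.refl _)
  | mul_top ε => exact .mul (.refl _) h

theorem IsTwist.isotopic (hf : IsTwist f) (h : Isotopic S T) : Isotopic (f S) (f T) := by
  cases hf with
  | add_right ε => exact h.add (.refl _)
  | add_left ε => exact .add (.refl _) h
  | mul_bottom ε => exact h.mul (.refl _)
  | mul_top ε => exact .mul (.refl _) h

theorem IsTwist.twistForm (hf : IsTwist f) (h : TwistForm S) : TwistForm (f S) := by
  cases hf with
  | add_right ε => exact h.add_right ε
  | add_left ε => exact h.add_left ε
  | mul_bottom ε => exact h.mul_bottom ε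
  | mul_top ε => exact h.mul_top ε

theorem IsTwist.onSubtangle {M : TwoTangle → TwoTangle → Prop} (hf : IsTwist f)
    (h : OnSubtangle M S T) : OnSubtangle M (f S) (f T) := by
  cases hf with
  | add_right ε => exact h.add_right ε
  | add_left ε => exact h.add_left ε
  | mul_bottom ε => exact h.mul_bottom ε
  | mul_top ε => exact h.mul_top ε

theorem IsTwist.reductionStep (hf : IsTwist f) (h : ReductionStep S T) :
    ReductionStep (f S) (f T) :=
  h.imp hf.planarIsotopic (.imp hf.onSubtangle (.imp hf.onSubtangle hf.onSubtangle))

theorem onSubtangle_induction {M P : TwoTangle → TwoTangle → Prop} (base : ∀ S T, M S T → P S T)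
    (step : ∀ f S T, IsTwist f → P S T → P (f S) (f T)) (h : OnSubtangle M S T) : P S T := by
  induction h with
  | base h => exact base _ _ h
  | add_right ε _ ih => exact step _ _ _ (.add_right ε) ih
  | add_left ε _ ih => exact step _ _ _ (.add_left ε) ih
  | mul_bottom ε _ ih => exact step _ _ _ (.mul_bottom ε) ih
  | mul_top ε _ ih => exact step _ _ _ (.mul_top ε) ih

theorem OnSubtangle.isotopic {M : TwoTangle → TwoTangle → Prop} (hM : ∀ S T, M S T → Isotopic S T)
    (h : OnSubtangle M S T) : Isotopic S T :=
  onSubtangle_induction hM (fun _ _ _ hf => hf.isotopic) h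

end IsTwist

/-! ### Equivalence under flypes -/

/-- A planar isotopy or a flype. -/
def FlypeStep (S T : TwoTangle) : Prop := PlanarIsotopic S T ∨ OnSubtangle Flype S T

/-- Each of the two tangles is obtained from the other by planar isotopies and flypes. -/
def FlypeEquiv (S T : TwoTangle) : Prop :=
  Relation.ReflTransGen FlypeStep S T ∧ Relation.ReflTransGen FlypeStep T S

namespace FlypeEquiv

theorem of_planar (h : PlanarIsotopic S T) : FlypeEquiv S T :=
  ⟨.single (.inl h), .single (.inl h.symm)⟩

theorem refl (S : TwoTangle) : FlypeEquiv S S := ⟨.refl, .refl⟩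

theorem symm (h : FlypeEquiv S T) : FlypeEquiv T S := ⟨h.2, h.1⟩

theorem trans (h : FlypeEquiv S T) (h' : FlypeEquiv T U) : FlypeEquiv S U :=
  ⟨h.1.trans h'.1, h'.2.trans h.2⟩

theorem twist {f : TwoTangle → TwoTangle} (hf : IsTwist f) (h : FlypeEquiv S T) :
    FlypeEquiv (f S) (f T) :=
  have step : ∀ S T, FlypeStep S T → FlypeStep (f S) (f T) := fun _ _ h =>
    h.imp hf.planarIsotopic hf.onSubtangle
  ⟨h.1.lift f step, h.2.lift f step⟩

theorem isotopic (h : FlypeEquiv S T) : Isotopic S T := by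
  obtain ⟨h, -⟩ := h
  induction h with
  | refl => exact .refl _
  | tail _ h ih =>
    rcases h with h | h
    · exact ih.trans h.isotopic
    · exact ih.trans (h.isotopic fun _ _ => Flype.isotopic)

end FlypeEquiv

theorem TwistForm.isRational (h : TwistForm S) : IsRational S := ⟨S, h, .refl S⟩

namespace TwistForm

/-- A twist on the left can be moved to the right, if flips do not change the tangle. -/
theorem flypeEquiv_add_of_hflip (h : TwistForm S) (hS : FlypeEquiv S.hflip S) (ε : Bool) :
    FlypeEquiv (unit ε + S) (S + unit ε) :=
  ⟨.head (.inr (.base (.right ε S h.isRational))) (hS.twist (.add_right ε)).1,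
    .head (.inr (.base (.left ε S h.isRational))) (hS.twist (.add_left ε)).1⟩

theorem flypeEquiv_mul_of_vflip (h : TwistForm S) (hS : FlypeEquiv S.vflip S) (ε : Bool) :
    FlypeEquiv (unit ε * S) (S * unit ε) :=
  ⟨.head (.inr (.base (.down ε S h.isRational))) (hS.twist (.mul_bottom ε)).1,
    .head (.inr (.base (.up ε S h.isRational))) (hS.twist (.mul_top ε)).1⟩

/-- A vertical flip moves a right twist to the left, and the flype that brings it back flips the
inner tangle horizontally. For products the roles are exchanged, so both flips need a joint
induction. -/
theorem flypeEquiv_flip (h : TwistForm S) : FlypeEquiv S.hflip S ∧ FlypeEquiv S.vflip S := by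
  induction h with
  | zero => exact ⟨.refl _, .refl _⟩
  | infty => exact ⟨.refl _, .refl _⟩
  | @add_right T ε h ih =>
    refine ⟨.trans (.of_planar (.hflip_add _ _)) (ih.1.twist (.add_right ε)), ?_⟩
    exact .trans (.of_planar (.vflip_add _ _)) ((ih.2.twist (.add_left ε)).trans
      (h.flypeEquiv_add_of_hflip ih.1 ε))
  | @add_left T ε h ih =>
    refine ⟨.trans (.of_planar (.hflip_add _ _)) (ih.1.twist (.add_left ε)), ?_⟩
    exact .trans (.of_planar (.vflip_add _ _)) ((ih.2.twist (.add_right ε)).trans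
      (h.flypeEquiv_add_of_hflip ih.1 ε).symm)
  | @mul_bottom T ε h ih =>
    rw [PlanarIsotopic.hflip_mul, PlanarIsotopic.vflip_mul]
    exact ⟨(ih.1.twist (.mul_top ε)).trans (h.flypeEquiv_mul_of_vflip ih.2 ε),
      ih.2.twist (.mul_bottom ε)⟩
  | @mul_top T ε h ih =>
    rw [PlanarIsotopic.hflip_mul, PlanarIsotopic.vflip_mul]
    exact ⟨(ih.1.twist (.mul_bottom ε)).trans (h.flypeEquiv_mul_of_vflip ih.2 ε).symm,
      ih.2.twist (.mul_top ε)⟩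

theorem flypeEquiv_add (h : TwistForm S) (ε : Bool) : FlypeEquiv (unit ε + S) (S + unit ε) :=
  h.flypeEquiv_add_of_hflip h.flypeEquiv_flip.1 ε

theorem flypeEquiv_mul (h : TwistForm S) (ε : Bool) : FlypeEquiv (unit ε * S) (S * unit ε) :=
  h.flypeEquiv_mul_of_vflip h.flypeEquiv_flip.2 ε

/-- Two quarter turns keep the sign of each twist and move it to the opposite side; a flype brings
it back. -/
theorem flypeEquiv_rot_rot (h : TwistForm S) : FlypeEquiv S.rot.rot S := by
  have hu (ε : Bool) : PlanarIsotopic (unit ε).rot.rot (unit ε) := by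
    simpa using (PlanarIsotopic.rot_unit ε).rot.trans (.rot_unit _)
  have hadd (S T : TwoTangle) : PlanarIsotopic (S + T).rot.rot (T.rot.rot + S.rot.rot) :=
    (PlanarIsotopic.rot_add S T).rot.trans (.rot_mul _ _)
  have hmul (S T : TwoTangle) : PlanarIsotopic (S * T).rot.rot (T.rot.rot * S.rot.rot) :=
    (PlanarIsotopic.rot_mul S T).rot.trans (.rot_add _ _)
  induction h with
  | zero => exact .of_planar (PlanarIsotopic.rot_zero.rot.trans .rot_infty)
  | infty => exact .of_planar (PlanarIsotopic.rot_infty.rot.trans .rot_zero)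
  | @add_right T ε h ih =>
    exact .trans (.of_planar ((hadd _ _).trans ((hu ε).add (.refl _))))
      ((ih.twist (.add_left ε)).trans (h.flypeEquiv_add ε))
  | @add_left T ε h ih =>
    exact .trans (.of_planar ((hadd _ _).trans (.add (.refl _) (hu ε))))
      ((ih.twist (.add_right ε)).trans (h.flypeEquiv_add ε).symm)
  | @mul_bottom T ε h ih =>
    exact .trans (.of_planar ((hmul _ _).trans ((hu ε).mul (.refl _))))
      ((ih.twist (.mul_top ε)).trans (h.flypeEquiv_mul ε))
  | @mul_top T ε h ih =>
    exact .trans (.of_planar ((hmul _ _).trans (.mul (.refl _) (hu ε))))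
      ((ih.twist (.mul_bottom ε)).trans (h.flypeEquiv_mul ε).symm)

end TwistForm

/-! ### Transfer moves and untwistings are isotopies -/

theorem isotopic_unit_mul_unit (ε : Bool) : Isotopic (unit ε * unit (!ε)) infty :=
  isotopic_iff.2 (cross_cancel ε 0 [] le_rfl)

theorem isotopic_unit_add_unit (ε : Bool) : Isotopic (unit (!ε) + unit ε) zero := by
  have hu : PlanarIsotopic (unit (!ε)).rot (unit ε) := by
    simpa using PlanarIsotopic.rot_unit (!ε)
  have h : PlanarIsotopic (unit (!ε) + unit ε) (unit ε * unit (!ε)).rot :=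
    ((PlanarIsotopic.rot_unit ε).symm.add hu.symm).trans (PlanarIsotopic.rot_mul _ _).symm
  exact h.isotopic.trans ((isotopic_unit_mul_unit ε).rot.trans PlanarIsotopic.rot_infty.isotopic)

theorem isotopic_mul_cancel (ε : Bool) (t : TwoTangle) :
    Isotopic (t * unit ε * unit (!ε)) t := by
  rw [PlanarIsotopic.mul_assoc]
  refine ((Isotopic.refl t).mul (isotopic_unit_mul_unit ε)).trans ?_
  rw [show t * infty = t from TwoTangle.ext (List.append_nil _)]
  exact .refl t

theorem isotopic_add_cancel (ε : Bool) (t : TwoTangle) :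
    Isotopic (t + unit (!ε) + unit ε) t :=
  (PlanarIsotopic.add_assoc _ _ _).isotopic.trans
    (((Isotopic.refl t).add (isotopic_unit_add_unit ε)).trans
      (PlanarIsotopic.add_zero t).isotopic)

theorem isotopic_infty_add (ε : Bool) : Isotopic (infty + unit ε) infty := by
  rw [isotopic_iff]
  refine .trans (.of_planar (cap_cross ε 1 _ (by decide))) ?_
  refine .trans (.cons _ (by decide) (cup_curl (!ε) 1 _ (by decide))) ?_
  exact .of_planar (zigzag_right 1 _ (by decide))

theorem isotopic_zero_mul (ε : Bool) : Isotopic (zero * unit ε) zero := by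
  rw [isotopic_iff]
  exact .cons _ (by decide) (cap_curl ε 0 [] (by decide))

theorem Untwist.isotopic (h : Untwist S T) : Isotopic S T := by
  cases h with
  | add ε => exact isotopic_add_cancel ε T
  | mul ε => simpa using isotopic_mul_cancel (!ε) T
  | infty ε => exact isotopic_infty_add ε
  | zero ε => exact isotopic_zero_mul ε

theorem IsRational.isotopic_vflip (h : IsRational T) : Isotopic T.vflip T := by
  obtain ⟨S, hS, e⟩ := h
  -- An auxiliary twist shows that `vflip` respects isotopy without a check of the local moves:
  -- flyping the twist produces the flips, and afterwards it is cancelled.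
  have hTS : Isotopic (T.vflip * unit true) (S.vflip * unit true) :=
    (isotopic_flype_down true T).symm.trans
      (((Isotopic.refl _).mul e).trans (isotopic_flype_down true S))
  exact (isotopic_mul_cancel true _).symm.trans ((hTS.mul (.refl (unit false))).trans
    ((isotopic_mul_cancel true _).trans (hS.flypeEquiv_flip.2.isotopic.trans e.symm)))

theorem isotopic_transfer_vflip (ε : Bool) (t : TwoTangle) :
    Isotopic ((t + unit (!ε)) * unit ε) (t.vflip.rot + unit ε) := by
  rw [isotopic_iff]
  have h1 : ((t + unit (!ε)) * unit ε).word = RationalTangle.cap 1 :: (shift 0 t.word ++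
      [cross (!ε) 2, RationalTangle.cup 1, cross ε 0]) := by
    rw [word_mul, word_add]
    simp [shift_cons, shift_nil, word_unit, cross]
  have h2 : (t.vflip.rot + unit ε).word = RationalTangle.cap 1 :: RationalTangle.cap 0 ::
      (shift 1 t.vflip.word ++ [RationalTangle.cup 2, cross ε 2, RationalTangle.cup 1]) := by
    rw [word_add, word_rot, shift_zero]
    simp [shift_cons, shift_nil, word_unit, cross]
  rw [h1, h2]
  -- The right twist is turned over the minimum and the bottom twist is lifted above it, so that
  -- both act on the three left strands.
  have h3 : WordEq IsotopyMove 4 [cross (!ε) 2, RationalTangle.cup 1, cross ε 0]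
      [cross ε 1, cross ε 0, RationalTangle.cup 2] := by
    refine .of_planar (.trans (cup_cross ε 1 _ le_rfl).symm (.cross_cons _ _ (by decide) ?_))
    exact (interchange (.cross ε) .cup 0 (j := 2) _ le_rfl (by decide) rfl).symm
  -- Apart from its rightmost strand the upper part has one strand on top and three below. The half
  -- twist of one strand is empty, so flipping this part costs only a half twist of three strands
  -- below it.
  have h4 : run 1 (RationalTangle.cap 1 :: shift 0 t.word) = some 3 :=
    run_cons_some.2 ⟨le_rfl, run_tangle t 0 (by decide)⟩
  have h5 := halfTwist_word (!ε) (N := 2) h4 [cross ε 1, cross ε 0, RationalTangle.cup 2]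
    (by decide)
  have h6 : vflipWord 1 (RationalTangle.cap 1 :: shift 0 t.word) =
      RationalTangle.cap 0 :: shift 1 t.vflip.word := by
    rw [shift_zero, word_vflip, ← vflipWord_add 1 t.wf]
    rfl
  rw [h6] at h5
  refine .trans (.cons _ (by decide) (.tangle t 0 (by decide) h3)) (.trans h5 ?_)
  refine .symm (.trans (.of_planar (interchange .cap .cap 0 (j' := 3) _ (by decide) (by decide)
    (by decide)).symm) ?_)
  refine .cons _ (by decide) ?_
  refine .trans (.of_planar (tangle_slice t.vflip .cap 1 3 _ (by decide) (by decide)).symm) ?_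
  refine .tangle _ _ (by decide) ?_
  refine .trans (.of_planar (zigzag_right 2 _ (by decide))) (.symm ?_)
  -- Two of the three crossings of the half twist cancel the two original crossings; the last one is
  -- the remaining twist.
  refine .trans (cross_braid (!ε) 0 _ (by decide)) ?_
  refine .trans (.cross_cons _ _ (by decide) (.cross_cons _ _ (by decide)
    (cross_cancel' ε 1 _ (by decide)))) ?_
  refine .trans (.cross_cons _ _ (by decide) (cross_cancel' ε 0 _ (by decide))) ?_
  have h7 := cup_cross (n := 4) (!ε) 1 [] le_rfl
  rw [Bool.not_not] at h7
  exact .of_planar h7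

theorem IsRational.isotopic_transfer_horizontal (h : IsRational T) (ε : Bool) :
    Isotopic ((T + unit (!ε)) * unit ε) (T.rot + unit ε) :=
  (isotopic_transfer_vflip ε T).trans (h.isotopic_vflip.rot.add (.refl _))

/-- Rotating the horizontal move puts the vertical twists on top instead of at the bottom; flypes
before and after correct this. -/
theorem IsRational.isotopic_transfer_vertical (h : IsRational T) (ε : Bool) :
    Isotopic ((T * unit (!ε)) + unit ε) (T.rot * unit ε) := by
  obtain ⟨S, hS, e⟩ := h
  obtain ⟨S', hS', e'⟩ := hS.exists_rot
  have hu : PlanarIsotopic (unit (!ε)).rot (unit ε) := by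
    simpa using PlanarIsotopic.rot_unit (!ε)
  have h1 := (hS'.isRational.isotopic_transfer_horizontal (!ε)).rot
  have h2 : PlanarIsotopic ((S' + unit (!(!ε))) * unit (!ε)).rot (unit (!ε) * S + unit ε) := by
    rw [Bool.not_not]
    exact (PlanarIsotopic.rot_mul _ _).trans
      (.add ((PlanarIsotopic.rot_add _ _).trans (.mul (.rot_unit ε) e')) hu)
  have h3 : PlanarIsotopic (S'.rot + unit (!ε)).rot (unit ε * S.rot) :=
    (PlanarIsotopic.rot_add _ _).trans (hu.mul e'.rot)
  obtain ⟨R, hR, eR⟩ := hS.rot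
  have h4 : Isotopic (T * unit (!ε)) (unit (!ε) * S) :=
    (e.mul (.refl _)).trans (hS.flypeEquiv_mul _).symm.isotopic
  refine (h4.add (.refl _)).trans (h2.isotopic.symm.trans (h1.trans (h3.isotopic.trans ?_)))
  refine ((Isotopic.refl _).mul eR.isotopic).trans ((hR.flypeEquiv_mul ε).isotopic.trans ?_)
  exact (eR.symm.isotopic.trans e.symm.rot).mul (.refl _)

theorem Transfer.isotopic (h : Transfer S T) : Isotopic S T := by
  cases h with
  | horizontal ε t h => exact h.isotopic_transfer_horizontal ε
  | vertical ε t h => exact h.isotopic_transfer_vertical ε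

end RationalTangle

/-! ### Crossing numbers, reduction to one sign, and alternation. -/

namespace RationalTangle

open TwoTangle

variable {S S' T T' U V : TwoTangle}

/-! ### Numbers of crossings -/

/-- The number of crossings of a word. -/
def wordCrossings (w : Word) : ℕ :=
  w.countP fun s => match s.gen with
    | .cross _ => true
    | _ => false

theorem crossings_eq (T : TwoTangle) : T.crossings = wordCrossings T.word := rfl

theorem wordCrossings_append (u v : Word) :
    wordCrossings (u ++ v) = wordCrossings u + wordCrossings v := List.countP_append

theorem wordCrossings_cons (s : Slice) (w : Word) :
    wordCrossings (s :: w) = wordCrossings [s] + wordCrossings w :=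
  wordCrossings_append [s] w

theorem wordCrossings_cap (i : ℕ) : wordCrossings [RationalTangle.cap i] = 0 := rfl

theorem wordCrossings_cup (i : ℕ) : wordCrossings [RationalTangle.cup i] = 0 := rfl

theorem wordCrossings_slice (g : Gen) (i j : ℕ) :
    wordCrossings [⟨g, i⟩] = wordCrossings [⟨g, j⟩] := rfl

theorem wordCrossings_shift (k : ℕ) (w : Word) : wordCrossings (shift k w) = wordCrossings w :=
  List.countP_map

theorem wordCrossings_hflip (w : Word) : wordCrossings (hflipWord w) = wordCrossings w := by
  rw [wordCrossings, hflipWord, List.countP_reverse, List.countP_map, wordCrossings]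
  congr 1
  funext s
  rcases s with ⟨_ | _ | _, i⟩ <;> rfl

theorem wordCrossings_vflip (n : ℕ) (w : Word) :
    wordCrossings (vflipWord n w) = wordCrossings w := by
  induction w generalizing n with
  | nil => rfl
  | cons s w ih =>
    rw [vflipWord, wordCrossings_cons, ih, wordCrossings_cons s]
    rfl

theorem crossings_add (S T : TwoTangle) : (S + T).crossings = S.crossings + T.crossings := by
  rw [crossings_eq, word_add, wordCrossings_cons, wordCrossings_append, wordCrossings_append,
    wordCrossings_shift, wordCrossings_shift, wordCrossings_cap, wordCrossings_cup, crossings_eq,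
    crossings_eq]
  omega

theorem crossings_mul (S T : TwoTangle) : (S * T).crossings = S.crossings + T.crossings :=
  wordCrossings_append _ _

theorem crossings_rot (T : TwoTangle) : T.rot.crossings = T.crossings := by
  rw [crossings_eq, word_rot, wordCrossings_cons, wordCrossings_append, wordCrossings_shift,
    wordCrossings_cap, wordCrossings_cup, crossings_eq]
  omega

theorem crossings_hflip (T : TwoTangle) : T.hflip.crossings = T.crossings := wordCrossings_hflip _

theorem crossings_vflip (T : TwoTangle) : T.vflip.crossings = T.crossings :=
  wordCrossings_vflip 2 _

theorem crossings_unit (ε : Bool) : (unit ε).crossings = 1 := rfl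

theorem wordCrossings_planarMove {x y : Word} (h : PlanarMove x y) :
    wordCrossings x = wordCrossings y := by
  cases h with
  | interchange g h i k =>
    rw [wordCrossings_cons, wordCrossings_cons ⟨h, i + g.ins + k⟩,
      wordCrossings_slice h _ (i + g.ins + k), add_comm]
  | _ => rfl

theorem PlanarIsotopic.crossings_eq (h : PlanarIsotopic S T) : S.crossings = T.crossings := by
  induction h with
  | rel S T h =>
    obtain ⟨p, q, x, y, h, hS, hT⟩ := h
    rw [RationalTangle.crossings_eq, RationalTangle.crossings_eq, hS, hT]
    simp only [wordCrossings_append, wordCrossings_planarMove h]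
  | refl => rfl
  | symm _ _ _ ih => exact ih.symm
  | trans _ _ _ _ _ ih ih' => exact ih.trans ih'

theorem IsTwist.crossings {f : TwoTangle → TwoTangle} (hf : IsTwist f) (S : TwoTangle) :
    (f S).crossings = S.crossings + 1 := by
  cases hf <;> simp only [crossings_add, crossings_mul, crossings_unit] <;> omega

theorem OnSubtangle.flype_crossings (h : OnSubtangle Flype S T) : T.crossings = S.crossings := by
  refine onSubtangle_induction (P := fun S T => T.crossings = S.crossings) ?_ ?_ h
  · intro S T h
    cases h <;>
      simp only [crossings_add, crossings_mul, crossings_unit, crossings_hflip, crossings_vflip] <;>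
      omega
  · intro f S T hf h
    rw [hf.crossings, hf.crossings, h]

theorem OnSubtangle.transfer_crossings (h : OnSubtangle Transfer S T) :
    T.crossings + 1 = S.crossings := by
  refine onSubtangle_induction (P := fun S T => T.crossings + 1 = S.crossings) ?_ ?_ h
  · intro S T h
    cases h <;> simp only [crossings_add, crossings_mul, crossings_unit, crossings_rot]
  · intro f S T hf h
    rw [hf.crossings, hf.crossings, h]

theorem OnSubtangle.untwist_crossings (h : OnSubtangle Untwist S T) :
    T.crossings < S.crossings := by
  refine onSubtangle_induction (P := fun S T => T.crossings < S.crossings) ?_ ?_ h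
  · intro S T h
    cases h <;> simp only [crossings_add, crossings_mul, crossings_unit] <;> omega
  · intro f S T hf h
    rw [hf.crossings, hf.crossings]
    omega

/-! ### Reduction -/

/-- A sequence of planar isotopies, flypes, transfer moves and untwistings. -/
def Reduces : TwoTangle → TwoTangle → Prop := Relation.ReflTransGen ReductionStep

namespace Reduces

theorem trans (h : Reduces S T) (h' : Reduces T U) : Reduces S U :=
  Relation.ReflTransGen.trans h h'

theorem of_planar (h : PlanarIsotopic S T) : Reduces S T := .single (.inl h)

theorem of_transfer (h : Transfer S T) : Reduces S T := .single (.inr (.inr (.inl (.base h))))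

theorem of_untwist (h : Untwist S T) : Reduces S T := .single (.inr (.inr (.inr (.base h))))

theorem of_flypeEquiv (h : FlypeEquiv S T) : Reduces S T :=
  h.1.lift id fun _ _ h => h.imp id .inl

theorem twist {f : TwoTangle → TwoTangle} (hf : IsTwist f) (h : Reduces S T) :
    Reduces (f S) (f T) :=
  h.lift f fun _ _ => hf.reductionStep

theorem isotopic (h : Reduces S T) : Isotopic S T := by
  induction h with
  | refl => exact .refl _
  | tail _ h ih =>
    rcases h with h | h | h | h
    · exact ih.trans h.isotopic
    · exact ih.trans (h.isotopic fun _ _ => Flype.isotopic)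
    · exact ih.trans (h.isotopic fun _ _ => Transfer.isotopic)
    · exact ih.trans (h.isotopic fun _ _ => Untwist.isotopic)

theorem crossings_le (h : Reduces S T) : T.crossings ≤ S.crossings := by
  induction h with
  | refl => exact le_rfl
  | tail _ h ih =>
    rcases h with h | h | h | h
    · exact h.crossings_eq ▸ ih
    · exact h.flype_crossings ▸ ih
    · have := h.transfer_crossings; omega
    · have := h.untwist_crossings; omega

end Reduces

theorem FlypeEquiv.crossings_eq (h : FlypeEquiv S T) : S.crossings = T.crossings :=
  le_antisymm (Reduces.of_flypeEquiv h.symm).crossings_le (Reduces.of_flypeEquiv h).crossings_le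

/-! ### Mirror images and inverses -/

theorem planarMove_mirror {x y : Word} (h : PlanarMove x y) :
    PlanarMove (mirrorWord x) (mirrorWord y) := by
  cases h with
  | interchange g h i k =>
    have := PlanarMove.interchange g.mirror h.mirror i k
    have e1 : g.mirror.outs = g.outs := by cases g <;> rfl
    have e2 : g.mirror.ins = g.ins := by cases g <;> rfl
    rw [e1, e2] at this
    exact this
  | zigzag_left i => exact .zigzag_left i
  | zigzag_right i => exact .zigzag_right i
  | cap_cross ε i => exact .cap_cross (!ε) i
  | cup_cross ε i => exact .cup_cross (!ε) i

theorem word_neg (T : TwoTangle) : (-T).word = mirrorWord T.word := rfl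

theorem mirrorWord_append (u v : Word) : mirrorWord (u ++ v) = mirrorWord u ++ mirrorWord v :=
  List.map_append

theorem mirrorWord_cons (s : Slice) (w : Word) :
    mirrorWord (s :: w) = ⟨s.gen.mirror, s.pos⟩ :: mirrorWord w := rfl

theorem mirrorWord_shift (k : ℕ) (w : Word) : mirrorWord (shift k w) = shift k (mirrorWord w) := by
  simp [mirrorWord, shift]

theorem PlanarIsotopic.neg (h : PlanarIsotopic S T) : PlanarIsotopic (-S) (-T) := by
  induction h with
  | rel S T h =>
    obtain ⟨p, q, x, y, h, hS, hT⟩ := h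
    exact .rel _ _ ⟨mirrorWord p, mirrorWord q, _, _, planarMove_mirror h,
      by simp only [word_neg, hS, mirrorWord_append],
      by simp only [word_neg, hT, mirrorWord_append]⟩
  | refl => exact .refl _
  | symm _ _ _ ih => exact ih.symm
  | trans _ _ _ _ _ ih ih' => exact ih.trans ih'

theorem tangle_neg_mul (S T : TwoTangle) : -(S * T) = -S * -T :=
  TwoTangle.ext (mirrorWord_append _ _)

theorem tangle_neg_add (S T : TwoTangle) : -(S + T) = -S + -T := by
  refine TwoTangle.ext ?_
  rw [word_neg, word_add, word_add, mirrorWord_cons, mirrorWord_append, mirrorWord_append,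
    mirrorWord_shift, mirrorWord_shift]
  rfl

theorem tangle_neg_neg (T : TwoTangle) : -(-T) = T := by
  refine TwoTangle.ext ?_
  have : ∀ s : Slice, (⟨s.gen.mirror.mirror, s.pos⟩ : Slice) = s := by
    rintro ⟨g, i⟩
    cases g <;> simp [Gen.mirror]
  simp [word_neg, mirrorWord, Function.comp_def, this]

theorem neg_unit (ε : Bool) : -unit ε = unit (!ε) := rfl

theorem rot_neg (T : TwoTangle) : (-T).rot = -T.rot := by
  refine TwoTangle.ext ?_
  rw [word_rot, word_neg, word_neg, word_rot, mirrorWord_cons, mirrorWord_append, mirrorWord_shift]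
  rfl

theorem inv_eq (T : TwoTangle) : T.inv = -T.rot := rfl

theorem inv_inv_eq (T : TwoTangle) : T.inv.inv = T.rot.rot := by
  rw [inv_eq, inv_eq, rot_neg, tangle_neg_neg]

theorem PlanarIsotopic.inv (h : PlanarIsotopic S T) : PlanarIsotopic S.inv T.inv := h.rot.neg

theorem PlanarIsotopic.inv_unit_add (ε : Bool) (T : TwoTangle) :
    PlanarIsotopic (unit ε + T).inv (T.inv * unit ε) := by
  have := ((rot_add (unit ε) T).trans (.mul (.refl _) (rot_unit ε))).neg
  rwa [tangle_neg_mul, neg_unit, Bool.not_not] at this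

/-! ### Diagrams that are planar isotopic to twist form -/

/-- The diagram is planar isotopic to a tangle in twist form. -/
def PlanarTwistForm (T : TwoTangle) : Prop := ∃ S, TwistForm S ∧ PlanarIsotopic T S

theorem TwistForm.planarTwistForm (h : TwistForm T) : PlanarTwistForm T := ⟨T, h, .refl T⟩

theorem TwistForm.neg (h : TwistForm T) : TwistForm (-T) := by
  induction h with
  | zero => exact .zero
  | infty => exact .infty
  | add_right ε _ ih => rw [tangle_neg_add]; exact ih.add_right _
  | add_left ε _ ih => rw [tangle_neg_add]; exact ih.add_left _
  | mul_bottom ε _ ih => rw [tangle_neg_mul]; exact ih.mul_bottom _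
  | mul_top ε _ ih => rw [tangle_neg_mul]; exact ih.mul_top _

namespace PlanarTwistForm

theorem congr (h : PlanarTwistForm T) (e : PlanarIsotopic S T) : PlanarTwistForm S := by
  obtain ⟨R, hR, h⟩ := h
  exact ⟨R, hR, e.trans h⟩

theorem twist {f : TwoTangle → TwoTangle} (hf : IsTwist f) (h : PlanarTwistForm T) :
    PlanarTwistForm (f T) := by
  obtain ⟨R, hR, h⟩ := h
  exact ⟨f R, hf.twistForm hR, hf.planarIsotopic h⟩

theorem rot (h : PlanarTwistForm T) : PlanarTwistForm T.rot := by
  obtain ⟨R, hR, h⟩ := h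
  exact hR.rot.imp fun _ h' => ⟨h'.1, h.rot.trans h'.2⟩

theorem inv (h : PlanarTwistForm T) : PlanarTwistForm T.inv := by
  obtain ⟨R, hR, h⟩ := h.rot
  exact ⟨-R, hR.neg, h.neg⟩

theorem isRational (h : PlanarTwistForm T) : IsRational T := by
  obtain ⟨R, hR, h⟩ := h
  exact ⟨R, hR, h.isotopic⟩

theorem flypeEquiv_add (h : PlanarTwistForm T) (ε : Bool) :
    FlypeEquiv (unit ε + T) (T + unit ε) := by
  obtain ⟨R, hR, h⟩ := h
  exact .trans (.of_planar (.add (.refl _) h))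
    ((hR.flypeEquiv_add ε).trans (.of_planar (h.symm.add (.refl _))))

theorem flypeEquiv_rot_rot (h : PlanarTwistForm T) : FlypeEquiv T.rot.rot T := by
  obtain ⟨R, hR, h⟩ := h
  exact .trans (.of_planar h.rot.rot) (hR.flypeEquiv_rot_rot.trans (.of_planar h.symm))

end PlanarTwistForm

/-! ### Continued fractions with terms of one sign -/

/-- The continued fraction all of whose terms have the sign `ε`, given by their absolute values. -/
def signedFrac (ε : Bool) : ℕ → List ℕ → TwoTangle
  | a, [] => twists ε a
  | a, b :: l => twists ε a + inv (signedFrac ε b l)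

theorem unit_add_twists (ε : Bool) (a : ℕ) :
    PlanarIsotopic (unit ε + twists ε a) (twists ε (a + 1)) := by
  induction a with
  | zero => exact (PlanarIsotopic.add_zero _).trans (PlanarIsotopic.zero_add _).symm
  | succ a ih => exact (PlanarIsotopic.add_assoc _ _ _).symm.trans (ih.add (.refl _))

/-- On the left a twist meets the integer term directly and planar isotopy suffices; a twist on the
right has to be flyped there first, as in `flypeEquiv_signedFrac_add`. -/
theorem unit_add_signedFrac (ε : Bool) (a : ℕ) (l : List ℕ) :
    PlanarIsotopic (unit ε + signedFrac ε a l) (signedFrac ε (a + 1) l) := by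
  cases l with
  | nil => exact unit_add_twists ε a
  | cons b l =>
    exact (PlanarIsotopic.add_assoc _ _ _).symm.trans ((unit_add_twists ε a).add (.refl _))

theorem planarTwistForm_signedFrac (ε : Bool) (a : ℕ) (l : List ℕ) :
    PlanarTwistForm (signedFrac ε a l) := by
  induction l generalizing a with
  | nil =>
    induction a with
    | zero => exact TwistForm.zero.planarTwistForm
    | succ a ih => exact PlanarTwistForm.twist (f := (· + unit ε)) (.add_right ε) ih
  | cons b l ih =>
    induction a with
    | zero => exact (ih b).inv.congr (.zero_add _)
    | succ a iha => exact (iha.twist (.add_left ε)).congr (unit_add_signedFrac ε a _).symm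

theorem flypeEquiv_signedFrac_add (ε : Bool) (a : ℕ) (l : List ℕ) :
    FlypeEquiv (signedFrac ε a l + unit ε) (signedFrac ε (a + 1) l) :=
  ((planarTwistForm_signedFrac ε a l).flypeEquiv_add ε).symm.trans
    (.of_planar (unit_add_signedFrac ε a l))

theorem signedFrac_zero_mul (ε : Bool) (b : ℕ) (l : List ℕ) :
    PlanarIsotopic (signedFrac ε 0 (b :: l) * unit ε) (signedFrac ε 0 ((b + 1) :: l)) :=
  ((PlanarIsotopic.zero_add _).mul (.refl _)).trans
    ((PlanarIsotopic.inv_unit_add ε _).symm.trans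
      ((unit_add_signedFrac ε b l).inv.trans (PlanarIsotopic.zero_add _).symm))

/-- Taking `T` as `1/(1/T)` exhibits it as a fraction with two leading zeros, the second of which
absorbs the bottom twist. Flypes enter because the double inverse is a rotation by a half turn. Two
terms are added, so the parity of the length is kept. -/
theorem flypeEquiv_signedFrac_mul (ε : Bool) (a : ℕ) (l : List ℕ) :
    FlypeEquiv (signedFrac ε a l * unit ε) (signedFrac ε 0 (1 :: a :: l)) := by
  have h : PlanarIsotopic (signedFrac ε 0 (0 :: a :: l)) (signedFrac ε a l).rot.rot := by
    rw [← inv_inv_eq]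
    exact (PlanarIsotopic.zero_add _).trans (PlanarIsotopic.zero_add _).inv
  have e := (planarTwistForm_signedFrac ε a l).flypeEquiv_rot_rot.symm.trans (.of_planar h.symm)
  exact (e.twist (.mul_bottom ε)).trans (.of_planar (signedFrac_zero_mul ε 0 (a :: l)))

/-- The tangle is `[∞]` or a continued fraction of odd length with terms of one sign. -/
def IsNormal (T : TwoTangle) : Prop :=
  T = infty ∨ ∃ (ε : Bool) (a : ℕ) (l : List ℕ), T = signedFrac ε a l ∧ Even l.length ∧
    ∀ b ∈ l, 0 < b

/-- The tangle can be reduced to a normal one. -/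
def HasNormalForm (T : TwoTangle) : Prop := ∃ S, IsNormal S ∧ Reduces T S

theorem IsNormal.hasNormalForm (h : IsNormal T) : HasNormalForm T := ⟨T, h, .refl⟩

theorem HasNormalForm.of_reduces (h : HasNormalForm T) (e : Reduces S T) : HasNormalForm S :=
  h.imp fun _ h => ⟨h.1, e.trans h.2⟩

theorem isNormal_signedFrac (ε : Bool) (a : ℕ) {l : List ℕ} (hl : Even l.length)
    (hl' : ∀ b ∈ l, 0 < b) : IsNormal (signedFrac ε a l) := .inr ⟨ε, a, l, rfl, hl, hl'⟩

theorem IsNormal.hasNormalForm_add (h : IsNormal T) (δ : Bool)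
    (ih : ∀ V, PlanarTwistForm V → V.crossings < (T + unit δ).crossings → HasNormalForm V) :
    HasNormalForm (T + unit δ) := by
  rcases h with rfl | ⟨ε, a, l, rfl, hl, hl'⟩
  · exact ⟨infty, .inl rfl, .of_untwist (.infty δ)⟩
  rcases eq_or_ne δ ε with rfl | hδ
  · exact ⟨_, isNormal_signedFrac δ (a + 1) hl hl', .of_flypeEquiv (flypeEquiv_signedFrac_add δ a l)⟩
  obtain rfl : ε = !δ := by cases δ <;> cases ε <;> simp_all
  cases a with
  | succ a =>
    exact ⟨_, isNormal_signedFrac (!δ) a hl hl',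
      (Reduces.of_flypeEquiv ((flypeEquiv_signedFrac_add (!δ) a l).symm.twist
        (.add_right δ))).trans (.of_untwist (.add δ _))⟩
  | zero =>
    cases l with
    | nil => exact (isNormal_signedFrac δ 1 (l := []) (by simp) (by simp)).hasNormalForm
    | cons b l =>
      -- One vertical twist is split off the second term to meet the new horizontal one. The
      -- transfer move rotates the rest, so the result is only known to be planar isotopic to twist
      -- form and goes to the induction hypothesis.
      obtain ⟨b, rfl⟩ := Nat.exists_eq_add_of_le' (hl' b (by simp))
      have hU := planarTwistForm_signedFrac (!δ) 0 (b :: l)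
      have e : PlanarIsotopic (signedFrac (!δ) 0 ((b + 1) :: l) + unit δ)
          (signedFrac (!δ) 0 (b :: l) * unit (!δ) + unit δ) :=
        (signedFrac_zero_mul (!δ) b l).symm.add (.refl _)
      have t := Transfer.vertical δ _ hU.isRational
      refine (ih _ (hU.rot.twist (.mul_bottom δ)) ?_).of_reduces
        ((Reduces.of_planar e).trans (.of_transfer t))
      have := (OnSubtangle.base t).transfer_crossings
      rw [e.crossings_eq]
      omega

theorem IsNormal.hasNormalForm_mul (h : IsNormal T) (δ : Bool)
    (ih : ∀ V, PlanarTwistForm V → V.crossings < (T * unit δ).crossings → HasNormalForm V) :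
    HasNormalForm (T * unit δ) := by
  rcases h with rfl | ⟨ε, a, l, rfl, hl, hl'⟩
  · exact ⟨_, isNormal_signedFrac δ 1 (l := []) (by simp) (by simp),
      .of_planar (PlanarIsotopic.zero_add (unit δ)).symm⟩
  rcases eq_or_ne δ ε with rfl | hδ
  · cases a with
    | zero =>
      cases l with
      | nil => exact ⟨_, isNormal_signedFrac δ 0 hl hl', .of_untwist (.zero δ)⟩
      | cons b l =>
        refine ⟨_, isNormal_signedFrac δ 0 (l := (b + 1) :: l) hl ?_,
          .of_planar (signedFrac_zero_mul δ b l)⟩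
        simpa using fun c hc => hl' c (by simp [hc])
    | succ a =>
      refine ⟨_, isNormal_signedFrac δ 0 (l := 1 :: (a + 1) :: l) ?_ ?_,
        .of_flypeEquiv (flypeEquiv_signedFrac_mul δ (a + 1) l)⟩
      · simpa [Nat.even_add_one] using hl
      · simpa using hl'
  obtain rfl : ε = !δ := by cases δ <;> cases ε <;> simp_all
  cases a with
  | succ a =>
    have hU := planarTwistForm_signedFrac (!δ) a l
    have e := (flypeEquiv_signedFrac_add (!δ) a l).symm.twist (.mul_bottom δ)
    have t := Transfer.horizontal δ _ hU.isRational
    refine (ih _ (hU.rot.twist (.add_right δ)) ?_).of_reduces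
      ((Reduces.of_flypeEquiv e).trans (.of_transfer t))
    have := (OnSubtangle.base t).transfer_crossings
    rw [e.crossings_eq]
    omega
  | zero =>
    cases l with
    | nil => exact ⟨_, isNormal_signedFrac δ 0 hl hl', .of_untwist (.zero δ)⟩
    | cons b l =>
      -- After the cancellation the second term may be zero, so the remaining fraction need not be
      -- normal and the induction hypothesis is used again.
      obtain ⟨b, rfl⟩ := Nat.exists_eq_add_of_le' (hl' b (by simp))
      have e : PlanarIsotopic (signedFrac (!δ) 0 ((b + 1) :: l) * unit δ)
          (signedFrac (!δ) 0 (b :: l) * unit (!δ) * unit δ) :=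
        (signedFrac_zero_mul (!δ) b l).symm.mul (.refl _)
      have t := Untwist.mul δ (signedFrac (!δ) 0 (b :: l))
      refine (ih _ (planarTwistForm_signedFrac (!δ) 0 (b :: l)) ?_).of_reduces
        ((Reduces.of_planar e).trans (.of_untwist t))
      have := (OnSubtangle.base t).untwist_crossings
      rw [e.crossings_eq]
      omega

theorem PlanarTwistForm.hasNormalForm (h : PlanarTwistForm T) : HasNormalForm T := by
  induction hn : T.crossings using Nat.strong_induction_on generalizing T with
  | h n ih =>
    obtain ⟨S, hS, e⟩ := h
    have hc := e.crossings_eq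
    refine HasNormalForm.of_reduces ?_ (.of_planar e)
    have add : ∀ S ε, TwistForm S → S.crossings + 1 = n → HasNormalForm (S + unit ε) := by
      intro S ε hS hc
      -- The inner tangle is normalised first. Since this never raises the number of crossings,
      -- whatever a later transfer or cancellation leaves still has fewer than `n`.
      obtain ⟨N, hN, r⟩ := ih S.crossings (by omega) hS.planarTwistForm rfl
      refine (hN.hasNormalForm_add ε fun V hV hV' => ih _ ?_ hV rfl).of_reduces
        (r.twist (.add_right ε))
      have := r.crossings_le
      rw [crossings_add, crossings_unit] at hV'
      omega
    have mul : ∀ S ε, TwistForm S → S.crossings + 1 = n → HasNormalForm (S * unit ε) := by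
      intro S ε hS hc
      obtain ⟨N, hN, r⟩ := ih S.crossings (by omega) hS.planarTwistForm rfl
      refine (hN.hasNormalForm_mul ε fun V hV hV' => ih _ ?_ hV rfl).of_reduces
        (r.twist (.mul_bottom ε))
      have := r.crossings_le
      rw [crossings_mul, crossings_unit] at hV'
      omega
    cases hS with
    | zero => exact (isNormal_signedFrac true 0 (l := []) (by simp) (by simp)).hasNormalForm
    | infty => exact IsNormal.hasNormalForm (.inl rfl)
    | add_right ε h =>
      rw [crossings_add, crossings_unit] at hc
      exact add _ ε h (by omega)
    | add_left ε h =>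
      rw [crossings_add, crossings_unit] at hc
      exact (add _ ε h (by omega)).of_reduces (.of_flypeEquiv (h.flypeEquiv_add ε))
    | mul_bottom ε h =>
      rw [crossings_mul, crossings_unit] at hc
      exact mul _ ε h (by omega)
    | mul_top ε h =>
      rw [crossings_mul, crossings_unit] at hc
      exact (mul _ ε h (by omega)).of_reduces (.of_flypeEquiv (h.flypeEquiv_mul ε))

/-! ### Alternating diagrams -/

theorem WordDirections.append {u v : Word} {a b c : List Bool} (hu : WordDirections u a b)
    (hv : WordDirections v b c) : WordDirections (u ++ v) a c := by
  induction hu with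
  | nil => exact hv
  | cons g w p q a b l hg _ ih => exact .cons g _ p q a b c hg (ih hv)

theorem WordDirections.shift {w : Word} {a b : List Bool} (h : WordDirections w a b)
    (p q : List Bool) :
    WordDirections (RationalTangle.shift p.length w) (p ++ a ++ q) (p ++ b ++ q) := by
  induction h with
  | nil => exact .nil _
  | cons g w p' q' a b l hg _ ih =>
    have := WordDirections.cons g _ (p ++ p') (q' ++ q) a b _ hg (by simpa using ih)
    simpa [shift_cons] using this

theorem WordDirections.mirror {w : Word} {a b : List Bool} (h : WordDirections w a b) :
    WordDirections (mirrorWord w) (a.map (!·)) (b.map (!·)) := by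
  induction h with
  | nil => exact .nil _
  | cons g w p q a b l hg _ ih =>
    have hg' : GenDirections g.mirror (a.map (!·)) (b.map (!·)) := by
      cases hg with
      | cap x => exact .cap (!x)
      | cup x => exact .cup (!x)
      | cross ε => exact .cross (!ε)
    have := WordDirections.cons g.mirror _ (p.map (!·)) (q.map (!·)) _ _ _ hg'
      (by simpa using ih)
    simpa [mirrorWord_cons] using this

/-- The diagram is alternating, with the directions of a crossing of type `ε` at the endpoints. -/
def AlternatingOfSign (ε : Bool) (T : TwoTangle) : Prop :=
  WordDirections T.word [ε, !ε] [ε, !ε]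

namespace AlternatingOfSign

variable {ε : Bool}

theorem alternating (h : AlternatingOfSign ε T) : Alternating T := ⟨_, _, rfl, h⟩

theorem unit (ε : Bool) : AlternatingOfSign ε (unit ε) :=
  .cons _ _ [] [] _ _ _ (.cross ε) (.nil _)

theorem zero (ε : Bool) : AlternatingOfSign ε zero :=
  .cons _ _ [] [] _ _ _ (.cup ε) (.cons _ _ [] [] _ _ _ (.cap ε) (.nil _))

theorem add (hS : AlternatingOfSign ε S) (hT : AlternatingOfSign ε T) :
    AlternatingOfSign ε (S + T) := by
  have hcap : GenDirections .cap [] [!ε, ε] := by simpa using GenDirections.cap (!ε)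
  have hcup : GenDirections .cup [!ε, ε] [] := by simpa using GenDirections.cup (!ε)
  rw [AlternatingOfSign, word_add]
  exact .cons .cap _ [ε] [!ε] _ _ _ hcap ((WordDirections.shift hS [] [ε, !ε]).append
    ((WordDirections.shift hT [ε, !ε] []).append (.cons .cup _ [ε] [!ε] _ _ _ hcup (.nil _))))

/-- A quarter turn reverses the pattern of directions at the endpoints, and switching all crossings
reverses every direction, which restores it. -/
theorem inv (hT : AlternatingOfSign ε T) : AlternatingOfSign ε T.inv := by
  have hcap : GenDirections .cap [] [!ε, ε] := by simpa using GenDirections.cap (!ε)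
  have hcup : GenDirections .cup [!ε, ε] [] := by simpa using GenDirections.cup (!ε)
  have h : WordDirections T.rot.word [!ε, ε] [!ε, ε] :=
    .cons .cap _ [] [!ε, ε] _ _ _ hcap ((WordDirections.shift hT [!ε] [ε]).append
      (.cons .cup _ [!ε, ε] [] _ _ _ hcup (.nil _)))
  have := h.mirror
  simp only [List.map_cons, List.map_nil, Bool.not_not] at this
  exact this

theorem signedFrac (ε : Bool) (a : ℕ) (l : List ℕ) : AlternatingOfSign ε (signedFrac ε a l) := by
  have twists (a : ℕ) : AlternatingOfSign ε (twists ε a) := by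
    induction a with
    | zero => exact zero ε
    | succ a ih => exact ih.add (unit ε)
  induction l generalizing a with
  | nil => exact twists a
  | cons b l ih => exact (twists a).add (ih b).inv

end AlternatingOfSign

/-- The integer with a given sign and absolute value. -/
def signedInt (ε : Bool) (a : ℕ) : ℤ := if ε then a else -a

theorem int_signedInt (ε : Bool) (a : ℕ) : int (signedInt ε a) = twists ε a := by
  cases ε with
  | true => simp [int, signedInt]
  | false =>
    cases a with
    -- `int 0` is formed with the positive sign, but a row of no twists does not depend on the sign.
    | zero => rfl
    | succ a =>
      have h : ¬ (0 : ℤ) ≤ -((a + 1 : ℕ) : ℤ) := by omega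
      simp only [int, signedInt, Bool.false_eq_true, if_false, decide_eq_false h, Int.natAbs_neg,
        Int.natAbs_natCast]

theorem contFrac_signedInt (ε : Bool) (a : ℕ) (l : List ℕ) :
    contFrac (signedInt ε a) (l.map (signedInt ε)) = signedFrac ε a l := by
  induction l generalizing a with
  | nil => exact int_signedInt ε a
  | cons b l ih => rw [List.map_cons, contFrac, ih, int_signedInt, signedFrac]

theorem IsNormal.eq_infty_or_isCanonical (h : IsNormal T) : T = infty ∨ IsCanonical T := by
  refine h.imp id ?_
  rintro ⟨ε, a, l, rfl, hl, hl'⟩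
  refine ⟨signedInt ε a, l.map (signedInt ε), (contFrac_signedInt ε a l).symm,
    by simpa using hl.add_one, ?_, (AlternatingOfSign.signedFrac ε a l).alternating⟩
  cases ε with
  | true => exact .inl ⟨by simp [signedInt], by simpa [signedInt] using hl'⟩
  | false => exact .inr ⟨by simp [signedInt], by simpa [signedInt] using hl'⟩

theorem TwistForm.exists_reduces (h : TwistForm T) :
    ∃ S, (S = TwoTangle.infty ∨ IsCanonical S) ∧ Reduces T S :=
  h.planarTwistForm.hasNormalForm.imp fun _ h => ⟨h.1.eq_infty_or_isCanonical, h.2⟩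

end RationalTangle

open RationalTangle in
theorem proposition2 :
    -- every rational tangle other than `[∞]` can be isotoped to canonical form
    (∀ T : TwoTangle, IsRational T →
      Isotopic T TwoTangle.infty ∨ ∃ S : TwoTangle, IsCanonical S ∧ Isotopic T S) ∧
    -- a tangle in twist form is reduced by planar isotopies, flypes, transfer moves and untwistings
    (∀ T : TwoTangle, TwistForm T →
      ∃ S : TwoTangle, (S = TwoTangle.infty ∨ IsCanonical S) ∧
        Relation.ReflTransGen ReductionStep T S) ∧
    -- flypes are isotopies that preserve the number of crossings
    (∀ S T : TwoTangle, OnSubtangle Flype S T → Isotopic S T ∧ T.crossings = S.crossings) ∧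
    -- transfer moves are isotopies that lower the number of crossings by one
    (∀ S T : TwoTangle, OnSubtangle Transfer S T → Isotopic S T ∧ T.crossings + 1 = S.crossings) ∧
    -- untwistings are isotopies that lower the number of crossings
    (∀ S T : TwoTangle, OnSubtangle Untwist S T → Isotopic S T ∧ T.crossings < S.crossings) := by
  refine ⟨fun T ⟨R, hR, e⟩ => ?_, fun T h => h.exists_reduces,
    fun S T h => ⟨h.isotopic fun _ _ => Flype.isotopic, h.flype_crossings⟩,
    fun S T h => ⟨h.isotopic fun _ _ => Transfer.isotopic, h.transfer_crossings⟩,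
    fun S T h => ⟨h.isotopic fun _ _ => Untwist.isotopic, h.untwist_crossings⟩⟩
  obtain ⟨S, rfl | hS, r⟩ := hR.exists_reduces
  · exact .inl (e.trans r.isotopic)
  · exact .inr ⟨S, hS, e.trans r.isotopic⟩
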